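/- Notation. Let $d\ge 1$. A point process $\Phi$ on $\mathbb{R}^d$ is a random Radon (locally finite) counting measure; it is simple if a.s. $\Phi(\{x\})\le 1$ for all $x$, stationary if its law is invariant under all translations of $\mathbb{R}^d$, and of intensity $\lambda$ if $\mathbb{E}\,\Phi(B)=\lambda|B|$ for all bounded Borel sets $B$. It is called $\nu$-weakly sub-Poisson if $\mathbb{P}(\Phi(B)=0)\le e^{-\mathbb{E}\Phi(B)}$ for all bounded Borel sets $B$; $\alpha$-weakly sub-Poisson if $\mathbb{E}\prod_{i=1}^n\Phi(B_i)\le\prod_{i=1}^n\mathbb{E}\,\Phi(B_i)$ for all $n$ and all mutually disjoint bounded Borel sets $B_1,\dots,B_n$; and weakly sub-Poisson if both hold. For $r\ge 0$ and $k\ge 1$ let $C_k(\Phi,r)$ be the set of all $y\in\mathbb{R}^d$ that lie in at least $k$ of the closed balls $B_r(X)$, $X\in\Phi$ (counted with multiplicity). A subset of $\mathbb{R}^d$ percolates if it contains an unbounded connected subset; a graph percolates if it has an infinite connected subgraph. Put $$r_c^k(\Phi)=\inf\{r\ge 0:\ \mathbb{P}(C_k(\Phi,r)\text{ percolates})>0\}\in[0,\infty],\qquad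 \inf\emptyset=\infty .$$ The $j$-dimensional faces of the Čech complex of $\Phi$ with radius $r$ are the sets of $j+1$ distinct points of $\Phi$ whose closed balls of radius $r$ have a common point; let $G_j(\Phi,r)$ be the graph on the $j$-dimensional faces in which two different faces are adjacent if they are contained in a common $(j+1)$-dimensional face. Theorem. Let $d\ge1$. There are constants $c(\lambda)>0$ and $c(\lambda,k)<\infty$ ($\lambda\in(0,\infty)$, $k\ge1$), which depend only on $\lambda$ and $d$, respectively on $\lambda$, $k$ and $d$, and not on the law of $\Phi$, such that for every simple stationary point process $\Phi$ on $\mathbb{R}^d$ of intensity $\lambda\in(0,\infty)$ the following holds. 1. If $\Phi$ is $\alpha$-weakly sub-Poisson, then $c(\lambda)\le r_c^1(\Phi)$. 2. If $d\ge2$ and $\Phi$ is $\nu$-weakly sub-Poisson, then $r_c^k(\Phi)\le c(\lambda,k)$ for all $k\ge 1$. 3. Hence, if $d\ge2$ and $\Phi$ is weakly sub-Poisson, then for all $k\ge1$ $$0<c(\lambda)\le r_c^1(\Phi)\le r_c^k(\Phi)\le c(\lambda,k)<\infty ,$$ and the critical radius $\inf\{r\ge 0:\ \mathbb{P}(G_{k-1}(\Phi,r)\text{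 percolates})>0\}$ for percolation of the $(k-1)$-dimensional faces of the Čech complex (clique percolation) also lies between $c(\lambda)$ and $c(\lambda,k)$. Moreover, for every simple point process $\Phi$ on $\mathbb{R}^d$ (stationary or not), almost surely, for all $k\ge 1$ and all $r\ge0$, the set $C_k(\Phi,r)$ percolates if and only if the graph $G_{k-1}(\Phi,r)$ percolates; in particular, the critical radii for $k$-percolation and for percolation of the $(k-1)$-dimensional faces of the Čech complex coincide. -/

import Mathlib

open MeasureTheory Set
open scoped NNReal ENNReal

/-- The Euclidean space `ℝ^d`. -/
abbrev Space (d : ℕ) : Type := EuclideanSpace ℝ (Fin d)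

/-- Bounded Borel subsets of `ℝ^d`. -/
def IsBddBorel {d : ℕ} (B : Set (Space d)) : Prop :=
  MeasurableSet B ∧ Bornology.IsBounded B

/-- The space of Radon counting measures on `ℝ^d`: the Borel measures whose value on every bounded
Borel set is a (finite) natural number. -/
def CountingMeasure (d : ℕ) : Type :=
  {μ : Measure (Space d) // ∀ B : Set (Space d), IsBddBorel B → ∃ n : ℕ, μ B = n}

/-- The σ-algebra on the counting measures, inherited from the one of `Measure (Space d)`. By
`CountingMeasure.measurable_iff` it is the one generated by the maps `μ ↦ μ B`, `B` bounded Borel. -/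
instance CountingMeasure.instMeasurableSpace (d : ℕ) : MeasurableSpace (CountingMeasure d) :=
  inferInstanceAs (MeasurableSpace
    {μ : Measure (Space d) // ∀ B : Set (Space d), IsBddBorel B → ∃ n : ℕ, μ B = n})

theorem CountingMeasure.measurable_iff {d : ℕ} {Ω : Type*} [MeasurableSpace Ω]
    (Φ : Ω → CountingMeasure d) :
    Measurable Φ ↔ ∀ B : Set (Space d), IsBddBorel B → Measurable (fun ω => (Φ ω).1 B) := by
  constructor
  · intro h B hB
    exact (Measure.measurable_coe hB.1).comp (measurable_subtype_coe.comp h)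
  · intro h
    refine Measurable.subtype_mk (f := fun ω => (Φ ω).1)
      (Measure.measurable_of_measurable_coe _ fun s hs => ?_)
    have key : ∀ ω, (Φ ω).1 s = ⨆ n : ℕ, (Φ ω).1 (s ∩ Metric.closedBall 0 (n : ℝ)) := by
      intro ω
      have hm : Monotone fun n : ℕ => s ∩ Metric.closedBall (0 : Space d) (n : ℝ) :=
        fun a b hab => inter_subset_inter_right _
          (Metric.closedBall_subset_closedBall (by exact_mod_cast hab))
      rw [← hm.measure_iUnion, ← inter_iUnion, Metric.iUnion_closedBall_nat, inter_univ]
    simp only [key]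
    exact Measurable.iSup fun n => h _ ⟨hs.inter measurableSet_closedBall,
      Metric.isBounded_closedBall.subset inter_subset_right⟩

/-- The translate of a counting measure by the vector `t` (every point `x` is moved to `x + t`). -/
noncomputable def CountingMeasure.translate {d : ℕ} (t : Space d) (μ : CountingMeasure d) :
    CountingMeasure d :=
  ⟨μ.1.map (fun x => x + t), by
    intro B hB
    rw [Measure.map_apply (measurable_add_const t) hB.1]
    refine μ.2 _ ⟨measurable_add_const t hB.1, ?_⟩
    have : (fun x : Space d => x + t) ⁻¹' B = (fun x : Space d => x + -t) '' B := by
      ext x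
      simp
    rw [this]
    obtain ⟨C, hC⟩ := isBounded_iff_forall_norm_le.1 hB.2
    refine isBounded_iff_forall_norm_le.2 ⟨C + ‖-t‖, ?_⟩
    rintro _ ⟨x, hx, rfl⟩
    exact (norm_add_le _ _).trans (by gcongr; exact hC x hx)⟩

theorem CountingMeasure.measurable_translate {d : ℕ} (t : Space d) :
    Measurable (CountingMeasure.translate t) := by
  rw [CountingMeasure.measurable_iff]
  intro B hB
  have : ∀ μ : CountingMeasure d,
      (CountingMeasure.translate t μ).1 B = μ.1 ((fun x => x + t) ⁻¹' B) :=
    fun μ => Measure.map_apply (measurable_add_const t) hB.1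
  simp only [this]
  exact (Measure.measurable_coe (measurable_add_const t hB.1)).comp measurable_subtype_coe

/-- A point process on `ℝ^d` is a random element of the space of counting measures. -/
def IsPointProcess {d : ℕ} {Ω : Type*} [MeasurableSpace Ω] (Φ : Ω → CountingMeasure d) : Prop :=
  Measurable Φ

/-- Almost surely no point has multiplicity larger than one. -/
def IsSimplePP {d : ℕ} {Ω : Type*} [MeasurableSpace Ω] (P : Measure Ω)
    (Φ : Ω → CountingMeasure d) : Prop :=
  ∀ᵐ ω ∂P, ∀ x : Space d, (Φ ω).1 {x} ≤ 1

/-- The distribution is invariant under all translations of `ℝ^d`. -/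
def IsStationaryPP {d : ℕ} {Ω : Type*} [MeasurableSpace Ω] (P : Measure Ω)
    (Φ : Ω → CountingMeasure d) : Prop :=
  ∀ t : Space d, P.map (fun ω => CountingMeasure.translate t (Φ ω)) = P.map Φ

/-- `𝔼 Φ(B)`. -/
noncomputable def meanCount {d : ℕ} {Ω : Type*} [MeasurableSpace Ω] (P : Measure Ω)
    (Φ : Ω → CountingMeasure d) (B : Set (Space d)) : ℝ≥0∞ :=
  ∫⁻ ω, (Φ ω).1 B ∂P

/-- The mean measure is `lam` times Lebesgue measure. -/
def HasIntensity {d : ℕ} {Ω : Type*} [MeasurableSpace Ω] (P : Measure Ω)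
    (Φ : Ω → CountingMeasure d) (lam : ℝ≥0) : Prop :=
  ∀ B : Set (Space d), IsBddBorel B → meanCount P Φ B = lam * volume B

/-- `ν`-weakly sub-Poisson: `ℙ(Φ(B) = 0) ≤ exp(-𝔼 Φ(B))` for all bounded Borel `B`
(with `exp(-∞) = 0`). -/
def NuWeaklySubPoisson {d : ℕ} {Ω : Type*} [MeasurableSpace Ω] (P : Measure Ω)
    (Φ : Ω → CountingMeasure d) : Prop :=
  ∀ B : Set (Space d), IsBddBorel B →
    P {ω | (Φ ω).1 B = 0} ≤ EReal.exp (-(meanCount P Φ B : EReal))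

/-- `α`-weakly sub-Poisson: `𝔼 ∏ Φ(B_i) ≤ ∏ 𝔼 Φ(B_i)` for all finite families of mutually disjoint
bounded Borel sets. -/
def AlphaWeaklySubPoisson {d : ℕ} {Ω : Type*} [MeasurableSpace Ω] (P : Measure Ω)
    (Φ : Ω → CountingMeasure d) : Prop :=
  ∀ (n : ℕ) (B : Fin n → Set (Space d)), (∀ i, IsBddBorel (B i)) →
    Pairwise (fun i j => Disjoint (B i) (B j)) →
    ∫⁻ ω, ∏ i, (Φ ω).1 (B i) ∂P ≤ ∏ i, meanCount P Φ (B i)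

/-- Weakly sub-Poisson: both conditions hold. -/
def WeaklySubPoisson {d : ℕ} {Ω : Type*} [MeasurableSpace Ω] (P : Measure Ω)
    (Φ : Ω → CountingMeasure d) : Prop :=
  NuWeaklySubPoisson P Φ ∧ AlphaWeaklySubPoisson P Φ

/-- The coverage number field: the number of points `x` of `μ`, counted with multiplicity, whose
closed ball of radius `r` contains `y`. -/
noncomputable def coverage {d : ℕ} (μ : CountingMeasure d) (r : ℝ≥0) (y : Space d) : ℝ≥0∞ :=
  ∫⁻ x, (Metric.closedBall x (r : ℝ)).indicator (fun _ => (1 : ℝ≥0∞)) y ∂μ.1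

/-- The `k`-covered set. -/
def coveredSet {d : ℕ} (μ : CountingMeasure d) (k : ℕ) (r : ℝ≥0) : Set (Space d) :=
  {y | (k : ℝ≥0∞) ≤ coverage μ r y}

/-- Percolation of a set: it contains an unbounded connected subset. -/
def SetPercolates {d : ℕ} (C : Set (Space d)) : Prop :=
  ∃ S : Set (Space d), S ⊆ C ∧ IsConnected S ∧ ¬ Bornology.IsBounded S

/-- The critical radius for `k`-percolation, in `[0, ∞]`, with `inf ∅ = ∞`. -/
noncomputable def criticalRadius {d : ℕ} {Ω : Type*} [MeasurableSpace Ω] (P : Measure Ω)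
    (Φ : Ω → CountingMeasure d) (k : ℕ) : ℝ≥0∞ :=
  sInf {ρ : ℝ≥0∞ | ∃ r : ℝ≥0, ρ = r ∧ 0 < P {ω | SetPercolates (coveredSet (Φ ω) k r)}}

/-- The points (atoms) of a counting measure. -/
def CountingMeasure.points {d : ℕ} (μ : CountingMeasure d) : Set (Space d) :=
  {x | μ.1 {x} ≠ 0}

/-- The faces of the Čech complex with radius `r` on the points of `μ`. -/
def cechFaces {d : ℕ} (μ : CountingMeasure d) (r : ℝ≥0) : Set (Finset (Space d)) :=
  {σ | σ.Nonempty ∧ (∀ x ∈ σ, x ∈ μ.points) ∧ (⋂ x ∈ σ, Metric.closedBall x (r : ℝ)).Nonempty}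

/-- The graph on the `j`-dimensional faces of the Čech complex (those with `j + 1` vertices): two
different faces are adjacent if they are contained in a common `(j + 1)`-dimensional face. -/
def cechFaceGraph {d : ℕ} (μ : CountingMeasure d) (r : ℝ≥0) (j : ℕ) :
    SimpleGraph {σ : Finset (Space d) // σ ∈ cechFaces μ r ∧ σ.card = j + 1} where
  Adj σ τ := σ ≠ τ ∧ ∃ ρ ∈ cechFaces μ r, ρ.card = j + 2 ∧ σ.1 ⊆ ρ ∧ τ.1 ⊆ ρ
  symm := ⟨fun _ _ ⟨hne, ρ, hρ, hc, h1, h2⟩ => ⟨hne.symm, ρ, hρ, hc, h2, h1⟩⟩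
  loopless := ⟨fun _ h => h.1 rfl⟩

/-- Percolation of a graph: it has an infinite connected subgraph. -/
def GraphPercolates {V : Type*} (G : SimpleGraph V) : Prop :=
  ∃ H : G.Subgraph, H.Connected ∧ H.verts.Infinite

/-- The critical radius for percolation of the `j`-dimensional faces of the Čech complex
(clique percolation), in `[0, ∞]`, with `inf ∅ = ∞`. -/
noncomputable def cliqueCriticalRadius {d : ℕ} {Ω : Type*} [MeasurableSpace Ω] (P : Measure Ω)
    (Φ : Ω → CountingMeasure d) (j : ℕ) : ℝ≥0∞ :=
  sInf {ρ : ℝ≥0∞ | ∃ r : ℝ≥0, ρ = r ∧ 0 < P {ω | GraphPercolates (cechFaceGraph (Φ ω) r j)}}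

/-! Both bounds are Peierls arguments on cubes of side `h`; sub-Poissonianity replaces independence.

Lower bound: if `2r < h`, touching balls have centres in equal or star-neighbouring cubes, and a
cube holds finitely many points. So percolation yields, from one fixed cube, self-avoiding
star-paths of occupied cubes of every length. An occupied cube has count at least 1, so the
α-condition bounds the probability that `n` given cubes are all occupied by `(λ h^d)^n`. There are
at most `(3^d)^n` paths with `n` steps; for small `h` the union bound tends to 0, and there are
countably many starting cubes (`measure_setPercolates_eq_zero`).

Upper bound: each site of `ℤ × ℤ` carries `k` disjoint cubes and is good if all are occupied.
Neighbouring good sites have overlapping `k`-covered balls, so an infinite good cluster suffices.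
The ν-condition, applied to a union of cubes, bounds the probability that `n` given sites are bad by
`(k exp(-λ h^d))^n`. If the cluster of the origin is finite, then for some `m` a self-avoiding
star-path of bad sites of length `m` starts at `(m, 0)`; for large `h` the sum over `m` of these
probabilities is below 1 (`measure_setPercolates_pos`). The planar duality
(`star_connected_boundary`) comes from the exactness of closed cochains on the square lattice.

Čech complex: for a simple configuration, the `k`-covered set is a locally finite union of compact
convex sets, the ball intersections of the `(k-1)`-faces. Adjacent faces have meeting intersections,
and faces whose intersections meet are joined by exchanging vertices, so both notions of percolation
agree (`setPercolates_iff_graphPercolates`). -/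

section CountingMeasure

/-! ### Counting measures as locally finite sets of atoms; coverage by ball intersections -/

variable {d : ℕ} (μ : CountingMeasure d)

theorem CountingMeasure.apply_lt_top {B : Set (Space d)} (hB : IsBddBorel B) : μ.1 B < ∞ := by
  obtain ⟨n, hn⟩ := μ.2 B hB
  simp [hn]

theorem CountingMeasure.one_le_apply {B : Set (Space d)} (hB : IsBddBorel B) (h : μ.1 B ≠ 0) :
    1 ≤ μ.1 B := by
  obtain ⟨n, hn⟩ := μ.2 B hB
  rw [hn] at h ⊢
  exact_mod_cast Nat.one_le_iff_ne_zero.2 (by simpa using h)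

theorem isBddBorel_singleton (x : Space d) : IsBddBorel {x} :=
  ⟨measurableSet_singleton x, Bornology.isBounded_singleton⟩

theorem isBddBorel_closedBall (x : Space d) (r : ℝ) : IsBddBorel (Metric.closedBall x r) :=
  ⟨measurableSet_closedBall, Metric.isBounded_closedBall⟩

theorem CountingMeasure.card_le_apply (σ : Finset (Space d)) (hσ : ∀ x ∈ σ, x ∈ μ.points) :
    (σ.card : ℝ≥0∞) ≤ μ.1 σ := by
  rw [← sum_measure_singleton]
  calc (σ.card : ℝ≥0∞) = ∑ x ∈ σ, 1 := by simp
    _ ≤ _ := Finset.sum_le_sum fun x hx =>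
      μ.one_le_apply (isBddBorel_singleton x) (hσ x hx)

theorem CountingMeasure.finite_points_inter {B : Set (Space d)} (hB : IsBddBorel B) :
    (μ.points ∩ B).Finite := by
  by_contra hinf
  obtain ⟨n, hn⟩ := μ.2 B hB
  obtain ⟨σ, hσ, hcard⟩ := Set.Infinite.exists_subset_card_eq hinf (n + 1)
  have h1 := μ.card_le_apply σ fun x hx => (hσ hx).1
  have h2 : μ.1 σ ≤ n := hn ▸ measure_mono fun x hx => (hσ hx).2
  have h3 := h1.trans h2
  rw [hcard] at h3
  have : n + 1 ≤ n := by exact_mod_cast h3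
  omega

/-- A counting measure has no diffuse part. -/
theorem CountingMeasure.apply_diff_points (B : Set (Space d)) :
    μ.1 (B \ μ.points) = 0 := by
  refine measure_null_of_locally_null _ fun x hx => ?_
  have hx0 : μ.1 {x} = 0 := by simpa [CountingMeasure.points] using hx.2
  have hanti : Antitone fun n : ℕ => Metric.closedBall x (1 / ((n : ℝ) + 1)) := fun a b hab =>
    Metric.closedBall_subset_closedBall (by gcongr)
  have hlim := tendsto_measure_iInter_atTop (μ := μ.1)
    (s := fun n : ℕ => Metric.closedBall x (1 / ((n : ℝ) + 1)))
    (fun n => measurableSet_closedBall.nullMeasurableSet) hanti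
    ⟨0, (μ.apply_lt_top (isBddBorel_closedBall x _)).ne⟩
  have hInter : (⋂ n : ℕ, Metric.closedBall x (1 / ((n : ℝ) + 1))) = {x} := by
    refine Subset.antisymm (fun y hy => ?_) (fun y hy => ?_)
    · have : dist y x ≤ 0 := ge_of_tendsto' tendsto_one_div_add_atTop_nhds_zero_nat
        fun n => Metric.mem_closedBall.1 (mem_iInter.1 hy n)
      exact dist_le_zero.1 this
    · rw [mem_singleton_iff] at hy
      subst hy
      exact mem_iInter.2 fun n => Metric.mem_closedBall_self (by positivity)
  -- Masses of balls shrinking to a non-atom tend to 0; being integers, they vanish once below 1.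
  rw [hInter, hx0] at hlim
  obtain ⟨n, hn⟩ := (hlim.eventually (gt_mem_nhds zero_lt_one)).exists
  refine ⟨Metric.closedBall x (1 / ((n : ℝ) + 1)),
    mem_nhdsWithin_of_mem_nhds (Metric.closedBall_mem_nhds x (by positivity)), ?_⟩
  by_contra h0
  exact absurd (μ.one_le_apply (isBddBorel_closedBall x _) h0) (not_le.2 hn)

theorem CountingMeasure.le_apply_iff (hμ : ∀ x, μ.1 {x} ≤ 1) {B : Set (Space d)}
    (hB : IsBddBorel B) (k : ℕ) :
    (k : ℝ≥0∞) ≤ μ.1 B ↔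
      ∃ σ : Finset (Space d), σ.card = k ∧ (∀ x ∈ σ, x ∈ μ.points) ∧ (σ : Set (Space d)) ⊆ B := by
  constructor
  · intro h
    set F := (μ.finite_points_inter hB).toFinset with hF
    have h1 : μ.1 B ≤ F.card := by
      calc μ.1 B ≤ μ.1 (B \ μ.points) + μ.1 (F : Set (Space d)) := by
            refine (measure_mono fun x hx => ?_).trans (measure_union_le _ _)
            by_cases hp : x ∈ μ.points
            · exact Or.inr (by simpa [hF] using ⟨hp, hx⟩)
            · exact Or.inl ⟨hx, hp⟩
        _ = ∑ x ∈ F, μ.1 {x} := by rw [μ.apply_diff_points B, zero_add, sum_measure_singleton]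
        _ ≤ ∑ x ∈ F, 1 := Finset.sum_le_sum fun x _ => hμ x
        _ = F.card := by simp
    have h2 : k ≤ F.card := by exact_mod_cast h.trans h1
    obtain ⟨σ, hσ, hc⟩ := Finset.exists_subset_card_eq h2
    refine ⟨σ, hc, fun x hx => ?_, fun x hx => ?_⟩
    · exact ((Set.Finite.mem_toFinset _).1 (hσ hx)).1
    · exact ((Set.Finite.mem_toFinset _).1 (hσ hx)).2
  · rintro ⟨σ, rfl, hσ, hB'⟩
    exact (μ.card_le_apply σ hσ).trans (measure_mono hB')

theorem coverage_eq (r : ℝ≥0) (y : Space d) :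
    coverage μ r y = μ.1 (Metric.closedBall y (r : ℝ)) := by
  rw [coverage, ← lintegral_indicator_one measurableSet_closedBall]
  congr 1
  ext x
  simp only [indicator, Metric.mem_closedBall, dist_comm x y, Pi.one_apply]

/-- The common part of the closed balls of radius `r` around the points of `σ`. -/
def ballInter (r : ℝ≥0) (σ : Finset (Space d)) : Set (Space d) :=
  ⋂ x ∈ σ, Metric.closedBall x (r : ℝ)

theorem mem_ballInter {r : ℝ≥0} {σ : Finset (Space d)} {y : Space d} :
    y ∈ ballInter r σ ↔ ∀ x ∈ σ, dist y x ≤ r := by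
  simp [ballInter]

theorem ballInter_anti (r : ℝ≥0) {σ τ : Finset (Space d)} (h : σ ⊆ τ) :
    ballInter r τ ⊆ ballInter r σ := fun _ hy =>
  mem_ballInter.2 fun x hx => mem_ballInter.1 hy x (h hx)

theorem isClosed_ballInter (r : ℝ≥0) (σ : Finset (Space d)) : IsClosed (ballInter r σ) :=
  isClosed_biInter fun _ _ => Metric.isClosed_closedBall

theorem convex_ballInter (r : ℝ≥0) (σ : Finset (Space d)) : Convex ℝ (ballInter r σ) :=
  convex_iInter₂ fun x _ => convex_closedBall x _

theorem mem_coveredSet_iff (hμ : ∀ x, μ.1 {x} ≤ 1) (k : ℕ) (r : ℝ≥0) (y : Space d) :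
    y ∈ coveredSet μ k r ↔
      ∃ σ : Finset (Space d), σ.card = k ∧ (∀ x ∈ σ, x ∈ μ.points) ∧ y ∈ ballInter r σ := by
  rw [coveredSet, mem_ofPred_eq, coverage_eq, μ.le_apply_iff hμ (isBddBorel_closedBall y _)]
  refine exists_congr fun σ => and_congr_right fun _ => and_congr_right fun _ => ?_
  rw [mem_ballInter]
  exact forall₂_congr fun x _ => by rw [Metric.mem_closedBall, dist_comm]

end CountingMeasure

/-! ### Percolation of the covered set versus percolation of Čech faces -/

section CechGraph

theorem graphPercolates_iff {V : Type*} (G : SimpleGraph V) :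
    GraphPercolates G ↔ ∃ v, {w | G.Reachable v w}.Infinite := by
  constructor
  · rintro ⟨H, hH, hinf⟩
    obtain ⟨v, hv⟩ := hinf.nonempty
    refine ⟨v, hinf.mono fun w hw => ?_⟩
    exact (hH.preconnected.coe ⟨v, hv⟩ ⟨w, hw⟩).map H.hom
  · rintro ⟨v, hv⟩
    refine ⟨(G.connectedComponentMk v).toSubgraph,
      SimpleGraph.ConnectedComponent.connected_toSubgraph _, hv.mono fun w hw => ?_⟩
    exact SimpleGraph.ConnectedComponent.sound (SimpleGraph.Reachable.symm hw)

variable {d : ℕ} (μ : CountingMeasure d) (r : ℝ≥0) (j : ℕ)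

/-- The `j`-dimensional faces of the Čech complex. -/
abbrev CechFace : Type := {σ : Finset (Space d) // σ ∈ cechFaces μ r ∧ σ.card = j + 1}

variable {μ r j}

theorem CechFace.points (σ : CechFace μ r j) {x : Space d} (hx : x ∈ σ.1) : x ∈ μ.points :=
  σ.2.1.2.1 x hx

theorem CechFace.nonempty_ballInter (σ : CechFace μ r j) : (ballInter r σ.1).Nonempty :=
  σ.2.1.2.2

theorem CechFace.nonempty (σ : CechFace μ r j) : σ.1.Nonempty := σ.2.1.1

theorem CechFace.adj_inter {σ τ : CechFace μ r j} (h : (cechFaceGraph μ r j).Adj σ τ) :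
    (ballInter r σ.1 ∩ ballInter r τ.1).Nonempty := by
  obtain ⟨_, ρ, hρ, _, h1, h2⟩ := h
  obtain ⟨y, hy⟩ : (ballInter r ρ).Nonempty := hρ.2.2
  exact ⟨y, ballInter_anti r h1 hy, ballInter_anti r h2 hy⟩

/-- Faces whose ball intersections meet can be joined by exchanging one vertex at a time. -/
theorem CechFace.reachable_of_mem {y : Space d} : ∀ (n : ℕ) (σ τ : CechFace μ r j),
    (σ.1 \ τ.1).card = n → y ∈ ballInter r σ.1 → y ∈ ballInter r τ.1 →
      (cechFaceGraph μ r j).Reachable σ τ := by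
  intro n
  induction n with
  | zero =>
    intro σ τ h _ _
    have hsub : σ.1 ⊆ τ.1 := Finset.sdiff_eq_empty_iff_subset.1 (Finset.card_eq_zero.1 h)
    have : σ = τ := Subtype.ext (Finset.eq_of_subset_of_card_le hsub (by rw [σ.2.2, τ.2.2]))
    exact this ▸ SimpleGraph.Reachable.refl _
  | succ n ih =>
    intro σ τ h hσ hτ
    obtain ⟨a, ha⟩ : (σ.1 \ τ.1).Nonempty := Finset.card_pos.1 (by omega)
    have hcard : (σ.1 \ τ.1).card = (τ.1 \ σ.1).card :=
      Finset.card_sdiff_comm (by rw [σ.2.2, τ.2.2])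
    obtain ⟨b, hb⟩ : (τ.1 \ σ.1).Nonempty := Finset.card_pos.1 (by omega)
    rw [Finset.mem_sdiff] at ha hb
    have hpts : ∀ x ∈ insert b σ.1, x ∈ μ.points := by
      intro x hx
      rcases Finset.mem_insert.1 hx with rfl | hx
      · exact τ.points hb.1
      · exact σ.points hx
    have hyρ : y ∈ ballInter r (insert b σ.1) := mem_ballInter.2 fun x hx => by
      rcases Finset.mem_insert.1 hx with rfl | hx
      · exact mem_ballInter.1 hτ _ hb.1
      · exact mem_ballInter.1 hσ x hx
    have hsub : insert b (σ.1.erase a) ⊆ insert b σ.1 :=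
      Finset.insert_subset_insert _ (Finset.erase_subset _ _)
    -- Exchange `a` for `b`. Both faces lie in `insert b σ.1`, a face one dimension up because `y`
    -- is within `r` of all its vertices.
    let σ' : CechFace μ r j := ⟨insert b (σ.1.erase a),
      ⟨⟨b, Finset.mem_insert_self _ _⟩, fun x hx => hpts x (hsub hx),
        ⟨y, ballInter_anti r hsub hyρ⟩⟩, by
        rw [Finset.card_insert_of_notMem fun hmem => hb.2 (Finset.mem_of_mem_erase hmem),
          Finset.card_erase_of_mem ha.1, σ.2.2]
        omega⟩
    have hadj : (cechFaceGraph μ r j).Adj σ σ' := by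
      refine ⟨fun heq => hb.2 ?_, insert b σ.1, ⟨⟨b, Finset.mem_insert_self _ _⟩, hpts, ⟨y, hyρ⟩⟩,
        by rw [Finset.card_insert_of_notMem hb.2, σ.2.2], Finset.subset_insert _ _, hsub⟩
      rw [heq]
      exact Finset.mem_insert_self _ _
    refine hadj.reachable.trans (ih σ' τ ?_ (ballInter_anti r hsub hyρ) hτ)
    have : σ'.1 \ τ.1 = (σ.1 \ τ.1).erase a := by
      ext x
      simp only [σ', Finset.mem_sdiff, Finset.mem_insert, Finset.mem_erase]
      constructor
      · rintro ⟨rfl | ⟨h1, h2⟩, h3⟩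
        · exact absurd hb.1 h3
        · exact ⟨h1, h2, h3⟩
      · rintro ⟨h1, h2, h3⟩
        exact ⟨Or.inr ⟨h1, h2⟩, h3⟩
    rw [this, Finset.card_erase_of_mem (Finset.mem_sdiff.2 ha), h]
    rfl

/-- All vertices of such a face lie within `R + r` of `y`, where there are only finitely many
points. -/
theorem CechFace.finite_meeting (y : Space d) (R : ℝ) :
    {σ : CechFace μ r j | (ballInter r σ.1 ∩ Metric.closedBall y R).Nonempty}.Finite := by
  have hfin := (μ.finite_points_inter (isBddBorel_closedBall y (R + r))).finite_subsets
  have hfin' : {σ : Finset (Space d) |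
      (σ : Set (Space d)) ⊆ μ.points ∩ Metric.closedBall y (R + r)}.Finite :=
    hfin.preimage Finset.coe_injective.injOn
  refine (hfin'.preimage Subtype.val_injective.injOn).subset ?_
  rintro σ ⟨z, hz, hzy⟩ x hx
  refine ⟨CechFace.points σ hx, ?_⟩
  have h1 := mem_ballInter.1 hz x hx
  rw [Metric.mem_closedBall] at hzy ⊢
  have := dist_triangle x z y
  rw [dist_comm x z] at this
  linarith

theorem CechFace.locallyFinite : LocallyFinite fun σ : CechFace μ r j => ballInter r σ.1 :=
  fun y => ⟨Metric.closedBall y 1, Metric.closedBall_mem_nhds y one_pos, finite_meeting y 1⟩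

theorem CechFace.isBounded_ballInter (σ : CechFace μ r j) :
    Bornology.IsBounded (ballInter r σ.1) := by
  obtain ⟨x, hx⟩ := σ.nonempty
  exact Metric.isBounded_closedBall.subset (biInter_subset_of_mem hx)

theorem mem_coveredSet_iff_cechFace (hμ : ∀ x, μ.1 {x} ≤ 1) (y : Space d) :
    y ∈ coveredSet μ (j + 1) r ↔ ∃ σ : CechFace μ r j, y ∈ ballInter r σ.1 := by
  rw [mem_coveredSet_iff μ hμ]
  constructor
  · rintro ⟨σ, hc, hp, hy⟩
    exact ⟨⟨σ, ⟨Finset.card_pos.1 (by omega), hp, ⟨y, hy⟩⟩, hc⟩, hy⟩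
  · rintro ⟨σ, hy⟩
    exact ⟨σ.1, σ.2.2, fun x hx => σ.points hx, hy⟩

/-- The covered set percolates if and only if the graph of faces does. -/
theorem setPercolates_iff_graphPercolates (hμ : ∀ x, μ.1 {x} ≤ 1) :
    SetPercolates (coveredSet μ (j + 1) r) ↔ GraphPercolates (cechFaceGraph μ r j) := by
  rw [graphPercolates_iff]
  constructor
  · rintro ⟨S, hSC, hS, hunb⟩
    obtain ⟨y₀, hy₀⟩ := hS.nonempty
    obtain ⟨σ₀, hσ₀⟩ := (mem_coveredSet_iff_cechFace hμ y₀).1 (hSC hy₀)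
    refine ⟨σ₀, fun hfin => ?_⟩
    -- `U` and `W` are closed by local finiteness and disjoint by vertex exchange, so the connected
    -- set `S` lies in one of them. A finite component would make `U` bounded.
    set U := ⋃ σ : {σ // (cechFaceGraph μ r j).Reachable σ₀ σ}, ballInter r σ.1.1 with hU
    set W := ⋃ σ : {σ // ¬ (cechFaceGraph μ r j).Reachable σ₀ σ}, ballInter r σ.1.1 with hW
    have hUc : IsClosed U :=
      (CechFace.locallyFinite.comp_injective Subtype.val_injective).isClosed_iUnion
        fun σ => isClosed_ballInter r σ.1.1
    have hWc : IsClosed W :=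
      (CechFace.locallyFinite.comp_injective Subtype.val_injective).isClosed_iUnion
        fun σ => isClosed_ballInter r σ.1.1
    have hSUW : S ⊆ U ∪ W := fun y hy => by
      obtain ⟨σ, hσ⟩ := (mem_coveredSet_iff_cechFace hμ y).1 (hSC hy)
      by_cases h : (cechFaceGraph μ r j).Reachable σ₀ σ
      · exact Or.inl (mem_iUnion.2 ⟨⟨σ, h⟩, hσ⟩)
      · exact Or.inr (mem_iUnion.2 ⟨⟨σ, h⟩, hσ⟩)
    have hdisj : S ∩ (U ∩ W) = ∅ := by
      rw [eq_empty_iff_forall_notMem]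
      rintro y ⟨_, hyU, hyW⟩
      obtain ⟨σ, hσ⟩ := mem_iUnion.1 hyU
      obtain ⟨τ, hτ⟩ := mem_iUnion.1 hyW
      exact τ.2 (σ.2.trans (CechFace.reachable_of_mem _ _ _ rfl hσ hτ))
    rcases isPreconnected_iff_subset_of_disjoint_closed.1 hS.isPreconnected U W hUc hWc hSUW hdisj
      with h | h
    · apply hunb
      have : Finite {σ // (cechFaceGraph μ r j).Reachable σ₀ σ} := hfin
      have hb : ∀ σ : {σ // (cechFaceGraph μ r j).Reachable σ₀ σ},
          Bornology.IsBounded (ballInter r σ.1.1) :=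
        fun σ => CechFace.isBounded_ballInter (μ := μ) (j := j) σ.1
      exact (Bornology.isBounded_iUnion.2 hb).subset h
    · have h1 : y₀ ∈ U := mem_iUnion.2 ⟨⟨σ₀, SimpleGraph.Reachable.refl _⟩, hσ₀⟩
      exact (hdisj.subset ⟨hy₀, h1, h hy₀⟩ : y₀ ∈ (∅ : Set (Space d)))
  · rintro ⟨σ₀, hinf⟩
    refine ⟨⋃ σ ∈ {σ | (cechFaceGraph μ r j).Reachable σ₀ σ}, ballInter r σ.1, ?_, ?_, ?_⟩
    · intro y hy
      obtain ⟨σ, _, hσ⟩ := mem_iUnion₂.1 hy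
      exact (mem_coveredSet_iff_cechFace hμ y).2 ⟨σ, hσ⟩
    · refine IsConnected.biUnion_of_reflTransGen ⟨σ₀, SimpleGraph.Reachable.refl _⟩
        (fun σ _ => ⟨CechFace.nonempty_ballInter σ, (convex_ballInter r σ.1).isPreconnected⟩) ?_
      intro σ hσ τ hτ
      have hστ : (cechFaceGraph μ r j).Reachable σ τ := (SimpleGraph.Reachable.symm hσ).trans hτ
      rw [SimpleGraph.reachable_iff_reflTransGen] at hστ
      clear hτ
      induction hστ with
      | refl => exact .refl
      | tail h1 h2 ih =>
        refine ih.tail ⟨CechFace.adj_inter h2, ?_⟩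
        exact SimpleGraph.Reachable.trans hσ ((SimpleGraph.reachable_iff_reflTransGen _ _).2 h1)
    · intro hb
      obtain ⟨R, hR⟩ := hb.subset_closedBall (0 : Space d)
      refine hinf ((CechFace.finite_meeting (μ := μ) (r := r) (j := j) 0 R).subset fun σ hσ => ?_)
      obtain ⟨y, hy⟩ := CechFace.nonempty_ballInter σ
      exact ⟨y, hy, hR (mem_iUnion₂.2 ⟨σ, hσ, hy⟩)⟩

end CechGraph

/-! ### Self-avoiding paths and the union bound over them -/

section Paths

/-- Along a graph, from `z` one can go along a self-avoiding path of every length up to the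
variation of a function changing by at most one in each step. -/
theorem SimpleGraph.Reachable.exists_injOn_path {V : Type*} {G : SimpleGraph V} {z w : V}
    (h : G.Reachable z w) (f : V → ℤ) (hf : ∀ u v, G.Adj u v → |f v - f u| ≤ 1) {n : ℕ}
    (hn : (n : ℤ) ≤ |f w - f z|) :
    ∃ p : ℕ → V, p 0 = z ∧ InjOn p (Iic n) ∧ ∀ i < n, G.Adj (p i) (p (i + 1)) := by
  obtain ⟨q, hq⟩ := h.exists_isPath
  have hlip : ∀ i ≤ q.length, |f (q.getVert i) - f z| ≤ i := by
    intro i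
    induction i with
    | zero => simp
    | succ i ih =>
      intro hi
      have h1 := ih (by omega)
      have h2 := hf _ _ (q.adj_getVert_succ (i := i) (by omega))
      have h3 := abs_sub_le (f (q.getVert (i + 1))) (f (q.getVert i)) (f z)
      push_cast
      linarith
  have hlen : n ≤ q.length := by
    have := hlip q.length le_rfl
    rw [q.getVert_length] at this
    exact_mod_cast hn.trans this
  exact ⟨q.getVert, q.getVert_zero, hq.getVert_injOn.mono fun i (hi : i ≤ n) => hi.trans hlen,
    fun i hi => q.adj_getVert_succ (by omega)⟩

/-- The sequence of vertices obtained from `z` by the steps `s`. -/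
def stepSeq {V T : Type*} (step : T → V → V) (z : V) (s : ℕ → T) : ℕ → V
  | 0 => z
  | i + 1 => step (s i) (stepSeq step z s i)

theorem stepSeq_congr {V T : Type*} (step : T → V → V) (z : V) {s s' : ℕ → T} {n : ℕ}
    (h : ∀ i < n, s i = s' i) : ∀ i ≤ n, stepSeq step z s i = stepSeq step z s' i := by
  intro i
  induction i with
  | zero => intro _; rfl
  | succ i ih => intro hi; simp only [stepSeq]; rw [h i (by omega), ih (by omega)]

/-- Union bound over self-avoiding paths. -/
theorem measure_exists_path_le {V T Ω : Type*} [Fintype T] [Nonempty T] [MeasurableSpace Ω]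
    (P : Measure Ω) (step : T → V → V) (X : Ω → Set V) (p : ℝ≥0∞)
    (hX : ∀ (n : ℕ) (z : Fin n → V), Function.Injective z → P {ω | ∀ i, z i ∈ X ω} ≤ p ^ n)
    (z : V) (n : ℕ) :
    P {ω | ∃ q : ℕ → V, q 0 = z ∧ InjOn q (Iic n) ∧ (∀ i < n, ∃ t, q (i + 1) = step t (q i)) ∧
      ∀ i ≤ n, q i ∈ X ω} ≤ p * (Fintype.card T * p) ^ n := by
  classical
  obtain ⟨t₀⟩ := ‹Nonempty T›
  -- The padding by `t₀` is immaterial: only the first `n` steps matter.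
  let ext : (Fin n → T) → ℕ → T := fun s i => if h : i < n then s ⟨i, h⟩ else t₀
  let A : (Fin n → T) → Set Ω := fun s =>
    {ω | InjOn (stepSeq step z (ext s)) (Iic n) ∧ ∀ i ≤ n, stepSeq step z (ext s) i ∈ X ω}
  have hA : ∀ s, P (A s) ≤ p ^ (n + 1) := by
    intro s
    -- The bound `hX` needs distinct vertices; step sequences that revisit a vertex contribute the
    -- empty event.
    by_cases hinj : InjOn (stepSeq step z (ext s)) (Iic n)
    · refine (measure_mono ?_).trans
        (hX (n + 1) (fun i => stepSeq step z (ext s) i) fun i j hij => ?_)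
      · exact fun ω hω i => hω.2 i (by omega)
      · exact Fin.ext (hinj (by simp only [mem_Iic]; omega) (by simp only [mem_Iic]; omega) hij)
    · have : A s = ∅ := by
        ext ω
        simp [A, hinj]
      simp [this]
  calc _ ≤ P (⋃ s, A s) := by
        refine measure_mono ?_
        rintro ω ⟨q, hq0, hinj, hstep, hmem⟩
        choose! t ht using hstep
        have hq : ∀ i ≤ n, stepSeq step z t i = q i := by
          intro i
          induction i with
          | zero => intro _; exact hq0.symm
          | succ i ih => intro hi; simp only [stepSeq]; rw [ih (by omega), ht i (by omega)]
        have hq' : ∀ i ≤ n, stepSeq step z (ext fun i => t i) i = q i := fun i hi => by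
          rw [← hq i hi]
          exact stepSeq_congr step z (fun j hj => by simp [ext, hj]) i hi
        refine mem_iUnion.2 ⟨fun i => t i, fun i hi j hj hij => ?_, fun i hi => ?_⟩
        · rw [hq' i hi, hq' j hj] at hij
          exact hinj hi hj hij
        · rw [hq' i hi]
          exact hmem i hi
    _ ≤ ∑ s, P (A s) := measure_iUnion_fintype_le _ _
    _ ≤ ∑ _s : Fin n → T, p ^ (n + 1) := Finset.sum_le_sum fun s _ => hA s
    _ = p * (Fintype.card T * p) ^ n := by
        simp only [Finset.sum_const, Finset.card_univ, Fintype.card_fun, Fintype.card_fin,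
          nsmul_eq_mul, Nat.cast_pow]
        rw [mul_pow]
        ring

end Paths

/-! ### Planar duality on the square lattice -/

section Duality

/-- Nearest neighbours in `ℤ × ℤ`. -/
def PlaneAdj (u v : ℤ × ℤ) : Prop :=
  (u.1 = v.1 ∧ |v.2 - u.2| = 1) ∨ (u.2 = v.2 ∧ |v.1 - u.1| = 1)

/-- Neighbours in `ℤ × ℤ`, diagonals included. -/
def PlaneStarAdj (u v : ℤ × ℤ) : Prop := |v.1 - u.1| ≤ 1 ∧ |v.2 - u.2| ≤ 1

theorem PlaneAdj.symm {u v : ℤ × ℤ} (h : PlaneAdj u v) : PlaneAdj v u := by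
  rcases h with ⟨h1, h2⟩ | ⟨h1, h2⟩
  · exact Or.inl ⟨h1.symm, by rwa [abs_sub_comm]⟩
  · exact Or.inr ⟨h1.symm, by rwa [abs_sub_comm]⟩

theorem planeAdj_right (a b : ℤ) : PlaneAdj (a, b) (a + 1, b) := Or.inr ⟨rfl, by simp⟩

theorem planeAdj_up (a b : ℤ) : PlaneAdj (a, b) (a, b + 1) := Or.inl ⟨rfl, by simp⟩

theorem PlaneAdj.cases_on {u v : ℤ × ℤ} (h : PlaneAdj u v) :
    (∃ a b, (u = (a, b) ∧ v = (a + 1, b)) ∨ (v = (a, b) ∧ u = (a + 1, b))) ∨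
    (∃ a b, (u = (a, b) ∧ v = (a, b + 1)) ∨ (v = (a, b) ∧ u = (a, b + 1))) := by
  obtain ⟨u1, u2⟩ := u
  obtain ⟨v1, v2⟩ := v
  simp only [PlaneAdj] at h
  simp only [Prod.mk.injEq]
  rcases h with ⟨h1, h2⟩ | ⟨h1, h2⟩
  · right
    rcases abs_eq zero_le_one |>.1 h2 with h | h
    · exact ⟨u1, u2, Or.inl ⟨⟨rfl, rfl⟩, by omega, by omega⟩⟩
    · exact ⟨v1, v2, Or.inr ⟨⟨rfl, rfl⟩, by omega, by omega⟩⟩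
  · left
    rcases abs_eq zero_le_one |>.1 h2 with h | h
    · exact ⟨u1, u2, Or.inl ⟨⟨rfl, rfl⟩, by omega, by omega⟩⟩
    · exact ⟨v1, v2, Or.inr ⟨⟨rfl, rfl⟩, by omega, by omega⟩⟩

/-- Discrete integration from 0: the witness is a signed sum, one of whose two parts is always
empty. -/
theorem Int.exists_sub_eq (g : ℤ → ℤ) : ∃ S : ℤ → ℤ, S 0 = 0 ∧ ∀ i, S (i + 1) - S i = g i := by
  refine ⟨fun i => ∑ j ∈ Finset.Ico 0 i, g j - ∑ j ∈ Finset.Ico i 0, g j, by simp, fun i => ?_⟩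
  beta_reduce
  rcases le_or_gt 0 i with h | h
  · rw [Finset.Ico_eq_empty_of_le (show (0 : ℤ) ≤ i + 1 by omega), Finset.Ico_eq_empty_of_le h]
    have : Finset.Ico 0 (i + 1) = insert i (Finset.Ico 0 i) := by
      ext x
      simp only [Finset.mem_Ico, Finset.mem_insert]
      omega
    rw [this, Finset.sum_insert (by simp)]
    simp
  · rw [Finset.Ico_eq_empty_of_le (show i + 1 ≤ (0 : ℤ) by omega), Finset.Ico_eq_empty_of_le h.le]
    have : Finset.Ico i 0 = insert i (Finset.Ico (i + 1) 0) := by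
      ext x
      simp only [Finset.mem_Ico, Finset.mem_insert]
      omega
    rw [this, Finset.sum_insert (by simp)]
    simp

/-- A cochain on the edges of `ℤ × ℤ` which is closed on all unit squares is exact. -/
theorem exists_primitive (e : ℤ × ℤ → ℤ × ℤ → ℤ)
    (hanti : ∀ u v, e v u = -e u v)
    (hsq : ∀ a b, e (a, b) (a + 1, b) + e (a + 1, b) (a + 1, b + 1) =
      e (a, b) (a, b + 1) + e (a, b + 1) (a + 1, b + 1)) :
    ∃ f : ℤ × ℤ → ℤ, ∀ u v, PlaneAdj u v → f v - f u = e u v := by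
  -- Integrate along the horizontal axis, then vertically; the square relation carries the
  -- horizontal increments off the axis.
  obtain ⟨S, _, hS⟩ := Int.exists_sub_eq fun i => e (i, 0) (i + 1, 0)
  choose T hT0 hT using fun a => Int.exists_sub_eq fun j => e (a, j) (a, j + 1)
  have hx : ∀ a b, (S (a + 1) + T (a + 1) b) - (S a + T a b) = e (a, b) (a + 1, b) := by
    intro a b
    induction b using Int.induction_on with
    | zero => rw [hT0, hT0, add_zero, add_zero]; exact hS a
    | succ i ih =>
      have h1 := hT a i
      have h2 := hT (a + 1) i
      have h3 := hsq a i
      linarith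
    | pred i ih =>
      have h1 := hT a (-i - 1)
      have h2 := hT (a + 1) (-i - 1)
      have h3 := hsq a (-i - 1)
      rw [sub_add_cancel] at h1 h2 h3
      linarith
  have hy : ∀ a b, (S a + T a (b + 1)) - (S a + T a b) = e (a, b) (a, b + 1) := by
    intro a b
    have := hT a b
    linarith
  refine ⟨fun u => S u.1 + T u.1 u.2, fun u v h => ?_⟩
  rcases h.cases_on with ⟨a, b, ⟨rfl, rfl⟩ | ⟨rfl, rfl⟩⟩ | ⟨a, b, ⟨rfl, rfl⟩ | ⟨rfl, rfl⟩⟩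
  · exact hx a b
  · rw [hanti, ← hx a b]; ring
  · exact hy a b
  · rw [hanti, ← hy a b]; ring

open Relation in
/-- The boundary of a connected set `A ⊆ ℤ × ℤ` towards a connected set `B`, which is closed under
taking neighbours outside `A`, is star-connected. -/
theorem star_connected_boundary {A B : Set (ℤ × ℤ)} {a₀ b₀ : ℤ × ℤ}
    (hA : ∀ v ∈ A, ReflTransGen (fun u v => PlaneAdj u v ∧ v ∈ A) a₀ v) (ha₀ : a₀ ∈ A)
    (hB : ∀ v ∈ B, ReflTransGen (fun u v => PlaneAdj u v ∧ v ∈ B) b₀ v) (hb₀ : b₀ ∈ B)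
    (hAB : Disjoint A B) (hclosed : ∀ u ∈ B, ∀ v, PlaneAdj u v → v ∉ A → v ∈ B)
    {u w a a' : ℤ × ℤ} (ha : a ∈ A) (ha' : a' ∈ A) (hu : u ∈ B) (hw : w ∈ B)
    (hau : PlaneAdj a u) (haw : PlaneAdj a' w) :
    ReflTransGen (fun x y => PlaneStarAdj x y ∧ y ∈ B ∧ ∃ a ∈ A, PlaneAdj a y) u w := by
  classical
  by_contra hcon
  -- The part of the boundary star-reachable from `u`; by assumption it misses `w`.
  set V : Set (ℤ × ℤ) := {v | v ∈ B ∧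
    ReflTransGen (fun x y => PlaneStarAdj x y ∧ y ∈ B ∧ ∃ a ∈ A, PlaneAdj a y) u v}
  have hVB : ∀ v, v ∈ V → v ∈ B := fun v hv => hv.1
  have hdis : ∀ v, v ∈ A → v ∉ B := fun v h1 h2 => Set.disjoint_left.1 hAB h1 h2
  have hVstar : ∀ x y, x ∈ V → PlaneStarAdj x y → y ∈ B → (∃ a ∈ A, PlaneAdj a y) → y ∈ V :=
    fun x y hx hxy hy ha => ⟨hy, hx.2.tail ⟨hxy, hy, ha⟩⟩
  let i (s : Set (ℤ × ℤ)) (v : ℤ × ℤ) : ℤ := if v ∈ s then 1 else 0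
  -- The signed indicator of edges from `A` to `V`. It is closed: the vertices of a unit square are
  -- mutual star-neighbours, so if one is in `V`, every edge of the square from `A` to `B` ends in
  -- `V`, and `e` is the increment of the indicator of `B`. On squares missing `V` it vanishes.
  let e (x y : ℤ × ℤ) : ℤ := i A x * i V y - i V x * i A y
  obtain ⟨f, hf⟩ := exists_primitive e (fun x y => by simp only [e]; ring) (by
    intro x y
    have hp := planeAdj_right x y
    have hq := planeAdj_up (x + 1) y
    have hr := planeAdj_up x y
    have hs := planeAdj_right x (y + 1)
    generalize hp' : ((x, y) : ℤ × ℤ) = p at *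
    generalize hq' : ((x + 1, y) : ℤ × ℤ) = q at *
    generalize hr' : ((x, y + 1) : ℤ × ℤ) = r at *
    generalize hs' : ((x + 1, y + 1) : ℤ × ℤ) = s at *
    have hstar : ∀ k ∈ ({p, q, r, s} : Set (ℤ × ℤ)), ∀ l ∈ ({p, q, r, s} : Set (ℤ × ℤ)),
        PlaneStarAdj k l := by
      subst hp' hq' hr' hs'
      rintro k (rfl | rfl | rfl | rfl) l (rfl | rfl | rfl | rfl) <;> simp [PlaneStarAdj]
    by_cases hex : ∃ k ∈ ({p, q, r, s} : Set (ℤ × ℤ)), k ∈ V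
    · obtain ⟨k, hk, hkV⟩ := hex
      have key : ∀ l ∈ ({p, q, r, s} : Set (ℤ × ℤ)), ∀ m ∈ ({p, q, r, s} : Set (ℤ × ℤ)),
          PlaneAdj l m → e l m = i B m - i B l := by
        have one : ∀ l ∈ ({p, q, r, s} : Set (ℤ × ℤ)), ∀ m ∈ ({p, q, r, s} : Set (ℤ × ℤ)),
            PlaneAdj l m → l ∈ A → m ∈ B → m ∈ V := fun l _ m hm hlm hl hmB =>
          hVstar k m hkV (hstar k hk m hm) hmB ⟨l, hl, hlm⟩
        intro l hl m hm hlm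
        have h1 := one l hl m hm hlm
        have h2 := one m hm l hl hlm.symm
        have h3 := hclosed l
        have h4 := hclosed m
        have h5 := hVB l
        have h6 := hVB m
        have h7 := hdis l
        have h8 := hdis m
        have h9 := fun h => h3 h m hlm
        have h10 := fun h => h4 h l hlm.symm
        simp only [e, i]
        by_cases lA : l ∈ A
        · have lB := h7 lA
          have lV : l ∉ V := fun h => lB (h5 h)
          by_cases mA : m ∈ A
          · have mV : m ∉ V := fun h => h8 mA (h6 h)
            simp [lV, lB, mV, h8 mA]
          · by_cases mB : m ∈ B
            · simp [lA, lB, lV, mA, mB, h1 lA mB]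
            · have mV : m ∉ V := fun h => mB (h6 h)
              simp [lB, lV, mB, mV]
        · by_cases mA : m ∈ A
          · have mB := h8 mA
            have mV : m ∉ V := fun h => mB (h6 h)
            by_cases lB : l ∈ B
            · simp [lA, lB, mA, mB, mV, h2 mA lB]
            · have lV : l ∉ V := fun h => lB (h5 h)
              simp [lB, mB, mV, lV]
          · by_cases lB : l ∈ B
            · simp [lA, mA, lB, h9 lB mA]
            · have mB : m ∉ B := fun h => lB (h10 h lA)
              simp [lA, mA, lB, mB]
      rw [key p (by simp) q (by simp) hp, key q (by simp) s (by simp) hq,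
        key p (by simp) r (by simp) hr, key r (by simp) s (by simp) hs]
      ring
    · push Not at hex
      have h0 : ∀ k ∈ ({p, q, r, s} : Set (ℤ × ℤ)), i V k = 0 := fun k hk => if_neg (hex k hk)
      simp only [e, h0 p (by simp), h0 q (by simp), h0 r (by simp), h0 s (by simp)]
      ring)
  have iV : ∀ v, v ∈ A → i V v = 0 := fun v hv => if_neg fun h => hdis v hv (hVB v h)
  have iA : ∀ v, v ∈ B → i A v = 0 := fun v hv => if_neg fun h => hdis v h hv
  have fA : ∀ v ∈ A, f v = f a₀ := by
    intro v hv
    suffices f v = f a₀ ∧ v ∈ A from this.1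
    have hv' := hA v hv
    clear hv
    induction hv' with
    | refl => exact ⟨rfl, ha₀⟩
    | tail _ h ih =>
      have := hf _ _ h.1
      simp only [e, iV _ h.2, iV _ ih.2] at this
      exact ⟨by linarith [ih.1], h.2⟩
  have fB : ∀ v ∈ B, f v = f b₀ := by
    intro v hv
    suffices f v = f b₀ ∧ v ∈ B from this.1
    have hv' := hB v hv
    clear hv
    induction hv' with
    | refl => exact ⟨rfl, hb₀⟩
    | tail _ h ih =>
      have := hf _ _ h.1
      simp only [e, iA _ h.2, iA _ ih.2] at this
      exact ⟨by linarith [ih.1], h.2⟩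
  -- The primitive is constant on `A` and on `B`, so every edge from `A` to `B` has the same
  -- increment; yet it is 1 towards `u ∈ V` and 0 towards `w ∉ V`.
  have hu1 := hf _ _ hau
  have hw1 := hf _ _ haw
  have huV : u ∈ V := ⟨hu, .refl⟩
  have hwV : w ∉ V := fun h => hcon h.2
  simp only [e, iV _ ha, iV _ ha', iA _ hu, iA _ hw, i, if_pos ha, if_pos ha', if_pos huV,
    if_neg hwV] at hu1 hw1
  rw [fA _ ha, fB _ hu] at hu1
  rw [fA _ ha', fB _ hw] at hw1
  omega

/-- Look at the first entry into `B`: were the vertex before it outside `A`, closedness would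
already put it in `B`. -/
theorem exists_crossing {A B : Set (ℤ × ℤ)}
    (hclosed : ∀ u ∈ B, ∀ v, PlaneAdj u v → v ∉ A → v ∈ B) (g : ℕ → ℤ × ℤ)
    (hg : ∀ i, PlaneAdj (g i) (g (i + 1))) {N : ℕ} (h0 : g 0 ∉ B) (hN : g N ∈ B) :
    ∃ m, g m ∈ A ∧ g (m + 1) ∈ B := by
  classical
  have hex : ∃ i, g i ∈ B := ⟨N, hN⟩
  have hpos : Nat.find hex ≠ 0 := fun h => h0 (h ▸ Nat.find_spec hex)
  obtain ⟨m, hm⟩ := Nat.exists_eq_succ_of_ne_zero hpos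
  have h1 : g (m + 1) ∈ B := by
    have := Nat.find_spec hex
    rwa [hm] at this
  have h2 : g m ∉ B := Nat.find_min hex (by omega)
  refine ⟨m, ?_, h1⟩
  by_contra h
  exact h2 (hclosed _ h1 _ (hg m).symm h)

-- A cluster is connected inside itself, the form in which `star_connected_boundary` asks for
-- connectedness.
open Relation in
theorem reflTransGen_mem {α : Type*} {r : α → α → Prop} {Y : Set α} {a : α} :
    ∀ v ∈ {v | ReflTransGen (fun u v => r u v ∧ v ∈ Y) a v},
      ReflTransGen (fun u v => r u v ∧
        v ∈ {v | ReflTransGen (fun u v => r u v ∧ v ∈ Y) a v}) a v := by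
  intro v hv
  induction (show ReflTransGen _ a v from hv) with
  | refl => exact .refl
  | tail h1 h2 ih => exact (ih h1).tail ⟨h2.1, h1.tail h2⟩

open Relation in
/-- If the nearest-neighbour cluster of the origin in `X` is finite, then for some `m` there
is a self-avoiding star-path of length `m` outside `X` starting at `(m, 0)`. -/
theorem exists_star_path_of_finite_cluster {X : Set (ℤ × ℤ)}
    (hfin : {v | ReflTransGen (fun u v => PlaneAdj u v ∧ v ∈ X) (0, 0) v}.Finite) :
    ∃ (m : ℕ) (p : ℕ → ℤ × ℤ), p 0 = ((m : ℤ), 0) ∧ InjOn p (Iic m) ∧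
      (∀ i < m, PlaneStarAdj (p i) (p (i + 1))) ∧ ∀ i ≤ m, p i ∉ X := by
  by_cases h0 : ((0, 0) : ℤ × ℤ) ∈ X
  swap
  · exact ⟨0, fun _ => (0, 0), rfl, fun i hi j hj _ =>
      (Nat.le_zero.1 hi).trans (Nat.le_zero.1 hj).symm, by simp, fun i _ => h0⟩
  set A := {v | ReflTransGen (fun u v => PlaneAdj u v ∧ v ∈ X) (0, 0) v}
  have hAX : ∀ v ∈ A, v ∈ X := by
    intro v hv
    rcases ReflTransGen.cases_tail hv with h | ⟨_, _, h⟩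
    · exact h ▸ h0
    · exact h.2
  obtain ⟨N, hN⟩ : ∃ N : ℕ, ∀ v ∈ A, v.1 < N ∧ v.2 < N := by
    obtain ⟨⟨b1, b2⟩, hb⟩ := hfin.bddAbove
    refine ⟨(b1 + 1).toNat + (b2 + 1).toNat, fun v hv => ?_⟩
    have h1 : v.1 ≤ b1 := (hb hv).1
    have h2 : v.2 ≤ b2 := (hb hv).2
    constructor <;> omega
  -- The component of `Aᶜ` containing `(N, 0)`. Climbing the column `N` and going left along the row
  -- `N`, both outside `A`, shows that it also contains `(0, N)`; hence both positive half-axes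
  -- cross from `A` into `B`.
  set B := {v | ReflTransGen (fun u v => PlaneAdj u v ∧ v ∈ Aᶜ) ((N : ℤ), 0) v}
  have hNA : (((N : ℤ), 0) : ℤ × ℤ) ∉ A := fun h => lt_irrefl _ (hN _ h).1
  have hAB : Disjoint A B := by
    refine Set.disjoint_left.2 fun v hvA hv => ?_
    rcases ReflTransGen.cases_tail hv with h | ⟨_, _, h⟩
    · exact hNA (h ▸ hvA)
    · exact h.2 hvA
  have hclosed : ∀ u ∈ B, ∀ v, PlaneAdj u v → v ∉ A → v ∈ B := fun u hu v huv hv =>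
    ReflTransGen.tail hu ⟨huv, hv⟩
  have hup : ∀ i : ℕ, (((N : ℤ), (i : ℤ)) : ℤ × ℤ) ∈ B := by
    intro i
    induction i with
    | zero => exact .refl
    | succ i ih =>
      refine hclosed _ ih _ ?_ fun h => lt_irrefl _ (hN _ h).1
      push_cast
      exact planeAdj_up _ _
  have hleft : ∀ i : ℕ, (((N : ℤ) - i, (N : ℤ)) : ℤ × ℤ) ∈ B := by
    intro i
    induction i with
    | zero => simpa using hup N
    | succ i ih =>
      refine hclosed _ ih _ ?_ fun h => lt_irrefl _ (hN _ h).2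
      have := (planeAdj_right ((N : ℤ) - (i + 1)) N).symm
      push_cast
      convert this using 2
      ring
  have h0A : ((0, 0) : ℤ × ℤ) ∈ A := .refl
  have h0B : ((0, 0) : ℤ × ℤ) ∉ B := Set.disjoint_left.1 hAB h0A
  obtain ⟨m, hm, hm'⟩ := exists_crossing hclosed (fun i : ℕ => (((i : ℤ), 0) : ℤ × ℤ))
    (fun i => by push_cast; exact planeAdj_right _ _) h0B (N := N) (hup 0)
  obtain ⟨l, hl, hl'⟩ := exists_crossing hclosed (fun i : ℕ => ((0, (i : ℤ)) : ℤ × ℤ))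
    (fun i => by push_cast; exact planeAdj_up _ _) h0B (N := N) (by simpa using hleft N)
  have hbd := star_connected_boundary reflTransGen_mem h0A reflTransGen_mem .refl hAB hclosed
    hm hl hm' hl' (by push_cast; exact planeAdj_right _ _) (by push_cast; exact planeAdj_up _ _)
  have hout : ∀ a v, a ∈ A → PlaneAdj a v → v ∈ B → v ∉ X := fun a v ha hav hv hvX =>
    Set.disjoint_left.1 hAB (ReflTransGen.tail ha ⟨hav, hvX⟩) hv
  let G : SimpleGraph (ℤ × ℤ) := SimpleGraph.mk
    (fun u v => u ≠ v ∧ PlaneStarAdj u v ∧ u ∉ X ∧ v ∉ X)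
    ⟨fun u v h => ⟨h.1.symm, ⟨by rw [abs_sub_comm]; exact h.2.1.1,
      by rw [abs_sub_comm]; exact h.2.1.2⟩, h.2.2.2, h.2.2.1⟩⟩ ⟨fun u h => h.1 rfl⟩
  have huX : (((m + 1 : ℕ) : ℤ), (0 : ℤ)) ∉ X :=
    hout _ _ hm (by push_cast; exact planeAdj_right _ _) hm'
  have hreach : ∀ w, ReflTransGen (fun x y => PlaneStarAdj x y ∧ y ∈ B ∧ ∃ a ∈ A, PlaneAdj a y)
      (((m + 1 : ℕ) : ℤ), (0 : ℤ)) w → G.Reachable (((m + 1 : ℕ) : ℤ), (0 : ℤ)) w ∧ w ∉ X := by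
    intro w hw
    induction hw with
    | refl => exact ⟨.refl _, huX⟩
    | @tail b c h1 h2 ih =>
      obtain ⟨hstar, hcB, a, ha, hac⟩ := h2
      have hcX := hout a c ha hac hcB
      refine ⟨?_, hcX⟩
      rcases eq_or_ne b c with rfl | hne
      · exact ih.1
      · exact ih.1.trans (SimpleGraph.Adj.reachable ⟨hne, hstar, ih.2, hcX⟩)
  -- The boundary joins `(m + 1, 0)` to a point of the vertical axis, so the first coordinate varies
  -- by `m + 1`, which forces that length.
  obtain ⟨p, hp0, hpinj, hpadj⟩ := (hreach _ hbd).1.exists_injOn_path (n := m + 1) Prod.fst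
    (fun u v h => h.2.1.1) (by
      change ((m + 1 : ℕ) : ℤ) ≤ |0 - ((m + 1 : ℕ) : ℤ)|
      rw [zero_sub, abs_neg]
      exact le_abs_self _)
  refine ⟨m + 1, p, hp0, hpinj, fun i hi => (hpadj i hi).2.1, fun i hi => ?_⟩
  rcases Nat.eq_zero_or_pos i with rfl | hpos
  · rw [hp0]; exact huX
  · have := (hpadj (i - 1) (by omega)).2.2.2
    rwa [Nat.sub_add_cancel hpos] at this

end Duality

/-! ### The partition of space into half-open cubes -/

section Cells

variable {d : ℕ}

/-- The half-open cube with side `h` and index `u`. -/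
def cell (h : ℝ) (u : Fin d → ℤ) : Set (Space d) := {x | ∀ i, ⌊x i / h⌋ = u i}

theorem EuclideanSpace.norm_le_of_forall_abs_le {x : Space d} {C : ℝ} (hC : 0 ≤ C)
    (h : ∀ i, |x i| ≤ C) : ‖x‖ ≤ d * C := by
  rw [EuclideanSpace.norm_eq]
  refine Real.sqrt_le_iff.2 ⟨by positivity, ?_⟩
  calc ∑ i, ‖x i‖ ^ 2 ≤ ∑ _i : Fin d, C ^ 2 :=
        Finset.sum_le_sum fun i _ => by gcongr; exact h i
    _ = d * C ^ 2 := by simp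
    _ ≤ (d * C) ^ 2 := by
        rw [mul_pow]
        gcongr
        exact_mod_cast Nat.le_self_pow two_ne_zero d

theorem mem_cell_iff {h : ℝ} (hh : 0 < h) {u : Fin d → ℤ} {x : Space d} :
    x ∈ cell h u ↔ ∀ i, h * u i ≤ x i ∧ x i < h * u i + h := by
  refine forall_congr' fun i => ?_
  rw [Int.floor_eq_iff, le_div_iff₀ hh, div_lt_iff₀ hh]
  constructor <;> rintro ⟨h1, h2⟩ <;> constructor <;> linarith

theorem disjoint_cell (h : ℝ) {u v : Fin d → ℤ} (huv : u ≠ v) :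
    Disjoint (cell h u) (cell h v) :=
  Set.disjoint_left.2 fun _ hu hv => huv (funext fun i => (hu i).symm.trans (hv i))

theorem cell_eq_preimage {h : ℝ} (hh : 0 < h) (u : Fin d → ℤ) :
    cell h u = WithLp.ofLp ⁻¹' (Set.pi univ fun i => Ico (h * u i) (h * u i + h)) := by
  ext x
  rw [mem_cell_iff hh]
  simp

theorem isBddBorel_cell {h : ℝ} (hh : 0 < h) (u : Fin d → ℤ) : IsBddBorel (cell h u) := by
  constructor
  · rw [cell_eq_preimage hh]
    exact (PiLp.volume_preserving_ofLp (Fin d)).measurable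
      (MeasurableSet.univ_pi fun i => measurableSet_Ico)
  · refine isBounded_iff_forall_norm_le.2 ⟨d * (∑ i, (|h * u i| + h)), fun x hx => ?_⟩
    refine EuclideanSpace.norm_le_of_forall_abs_le (by positivity) fun i => ?_
    refine le_trans ?_ (Finset.single_le_sum (f := fun i => |h * (u i : ℝ)| + h)
      (fun i _ => by positivity) (Finset.mem_univ i))
    obtain ⟨h1, h2⟩ := (mem_cell_iff hh).1 hx i
    have h3 := le_abs_self (h * (u i : ℝ))
    have h4 := neg_abs_le (h * (u i : ℝ))
    rw [abs_le]
    constructor <;> linarith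

theorem volume_cell {h : ℝ≥0} (hh : 0 < h) (u : Fin d → ℤ) :
    volume (cell (h : ℝ) u) = (h : ℝ≥0∞) ^ d := by
  rw [cell_eq_preimage (by exact_mod_cast hh),
    (PiLp.volume_preserving_ofLp (Fin d)).measure_preimage
      (MeasurableSet.univ_pi fun i => measurableSet_Ico).nullMeasurableSet, volume_pi_pi]
  simp

theorem mem_cell_floor (h : ℝ) (x : Space d) : x ∈ cell h fun i => ⌊x i / h⌋ := fun _ => rfl

end Cells

/-! ### No percolation at small radius -/

section LowerBound

variable {d : ℕ}

theorem Int.abs_floor_sub_floor_le {a b : ℝ} (h : |a - b| < 1) : |⌊a⌋ - ⌊b⌋| ≤ 1 := by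
  have h1 := Int.floor_le a
  have h2 := Int.lt_floor_add_one a
  have h3 := Int.floor_le b
  have h4 := Int.lt_floor_add_one b
  rw [abs_lt] at h
  have h5 : (⌊a⌋ : ℝ) < ⌊b⌋ + 2 := by linarith
  have h6 : (⌊b⌋ : ℝ) < ⌊a⌋ + 2 := by linarith
  have h7 : ⌊a⌋ < ⌊b⌋ + 2 := by exact_mod_cast h5
  have h8 : ⌊b⌋ < ⌊a⌋ + 2 := by exact_mod_cast h6
  rw [abs_le]
  omega

/-- Project the infinite cluster of points to its cubes. The start `z` does not depend on `n`, so
the event is a countable union over `z` of intersections over `n`. -/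
theorem exists_cell_path {μ : CountingMeasure d} {r : ℝ≥0} {h : ℝ} (hrh : 2 * (r : ℝ) < h)
    (hperc : GraphPercolates (cechFaceGraph μ r 0)) :
    ∃ z : Fin d → ℤ, ∀ n : ℕ, ∃ q : ℕ → Fin d → ℤ, q 0 = z ∧ InjOn q (Iic n) ∧
      (∀ i < n, ∀ l, |q (i + 1) l - q i l| ≤ 1) ∧ ∀ i ≤ n, μ.1 (cell h (q i)) ≠ 0 := by
  have hh : 0 < h := lt_of_le_of_lt (by positivity) hrh
  rw [graphPercolates_iff] at hperc
  obtain ⟨σ₀, hinf⟩ := hperc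
  have hpt : ∀ σ : CechFace μ r 0, ∃ x, σ.1 = {x} := fun σ => Finset.card_eq_one.1 σ.2.2
  choose pt hpt using hpt
  have hpt_mem : ∀ σ : CechFace μ r 0, pt σ ∈ σ.1 := fun σ => by
    rw [hpt σ]; exact Finset.mem_singleton_self _
  let ix : CechFace μ r 0 → Fin d → ℤ := fun σ l => ⌊pt σ l / h⌋
  have hocc : ∀ σ, μ.1 (cell h (ix σ)) ≠ 0 := fun σ h0 =>
    CechFace.points σ (hpt_mem σ)
      (measure_mono_null (singleton_subset_iff.2 (mem_cell_floor h (pt σ))) h0)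
  have hadj : ∀ σ τ, (cechFaceGraph μ r 0).Adj σ τ → ∀ l, |ix τ l - ix σ l| ≤ 1 := by
    intro σ τ hστ l
    obtain ⟨y, hy1, hy2⟩ := CechFace.adj_inter hστ
    have h1 := mem_ballInter.1 hy1 _ (hpt_mem σ)
    have h2 := mem_ballInter.1 hy2 _ (hpt_mem τ)
    have h3 : ‖pt τ - pt σ‖ ≤ 2 * r := by
      rw [← dist_eq_norm]
      have := dist_triangle_left (pt τ) (pt σ) y
      linarith
    have h4 := PiLp.norm_apply_le (pt τ - pt σ) l
    refine Int.abs_floor_sub_floor_le ?_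
    rw [← sub_div, abs_div, abs_of_pos hh, div_lt_one hh]
    exact (h4.trans h3).trans_lt hrh
  have hfib : ∀ u, (ix ⁻¹' {u}).Finite := by
    intro u
    have hfin := μ.finite_points_inter (isBddBorel_cell hh u)
    refine Set.Finite.subset (hfin.preimage (f := pt) fun σ _ τ _ hst => ?_) fun σ hσ => ?_
    · exact Subtype.ext (by rw [hpt σ, hpt τ, hst])
    · exact ⟨CechFace.points σ (hpt_mem σ), fun l => congrFun hσ l⟩
  let G : SimpleGraph (Fin d → ℤ) := SimpleGraph.mk
    (fun u v => u ≠ v ∧ (∀ l, |v l - u l| ≤ 1) ∧ μ.1 (cell h u) ≠ 0 ∧ μ.1 (cell h v) ≠ 0)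
    ⟨fun u v h => ⟨h.1.symm, fun l => by rw [abs_sub_comm]; exact h.2.1 l, h.2.2.2, h.2.2.1⟩⟩
    ⟨fun u h => h.1 rfl⟩
  have hreach : ∀ σ, (cechFaceGraph μ r 0).Reachable σ₀ σ → G.Reachable (ix σ₀) (ix σ) := by
    intro σ hσ
    rw [SimpleGraph.reachable_iff_reflTransGen] at hσ
    induction hσ with
    | refl => exact .refl _
    | @tail τ ρ _ h2 ih =>
      rcases eq_or_ne (ix τ) (ix ρ) with heq | hne
      · exact heq ▸ ih
      · exact ih.trans (SimpleGraph.Adj.reachable ⟨hne, hadj _ _ h2, hocc _, hocc _⟩)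
  refine ⟨ix σ₀, fun n => ?_⟩
  obtain ⟨σ, hσ, l, hl⟩ : ∃ σ, (cechFaceGraph μ r 0).Reachable σ₀ σ ∧
      ∃ l, (n : ℤ) ≤ |ix σ l - ix σ₀ l| := by
    by_contra hcon
    push Not at hcon
    -- Otherwise the cluster occupies only a finite box of cubes, each with finitely many points.
    refine hinf (Set.Finite.subset (Set.Finite.preimage' (f := ix) (Set.finite_Icc
      (fun l => ix σ₀ l - n) (fun l => ix σ₀ l + n)) fun u _ => hfib u) fun σ hσ => ?_)
    have := fun l => abs_lt.1 (hcon σ hσ l)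
    exact ⟨fun l => by linarith [(this l).1], fun l => by linarith [(this l).2]⟩
  obtain ⟨q, hq0, hqinj, hqadj⟩ := (hreach σ hσ).exists_injOn_path (fun u => u l)
    (fun u v h => h.2.1 l) hl
  refine ⟨q, hq0, hqinj, fun i hi => (hqadj i hi).2.1, fun i hi => ?_⟩
  rcases Nat.eq_zero_or_pos i with rfl | hpos
  · rw [hq0]; exact hocc _
  · have := (hqadj (i - 1) (by omega)).2.2.2
    rwa [Nat.sub_add_cancel hpos] at this

variable {Ω : Type*} [MeasurableSpace Ω] {P : Measure Ω} {Φ : Ω → CountingMeasure d}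

/-- Counts are integers, so the product of the counts is at least 1 on this event, and Markov's
inequality applies. -/
theorem AlphaWeaklySubPoisson.measure_forall_ne_zero_le (hΦ : IsPointProcess Φ)
    (hα : AlphaWeaklySubPoisson P Φ) {n : ℕ} {B : Fin n → Set (Space d)}
    (hB : ∀ i, IsBddBorel (B i)) (hdisj : Pairwise fun i j => Disjoint (B i) (B j)) :
    P {ω | ∀ i, (Φ ω).1 (B i) ≠ 0} ≤ ∏ i, meanCount P Φ (B i) := by
  refine le_trans ?_ (hα n B hB hdisj)
  exact meas_le_lintegral₀ (Finset.measurable_prod _ fun i _ =>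
    (CountingMeasure.measurable_iff Φ).1 hΦ _ (hB i)).aemeasurable
    fun ω hω => Finset.one_le_prod'' fun i => (Φ ω).one_le_apply (hB i) (hω i)

theorem measure_setPercolates_eq_zero (hΦ : IsPointProcess Φ) (hs : IsSimplePP P Φ) {lam : ℝ≥0}
    (hint : HasIntensity P Φ lam) (hα : AlphaWeaklySubPoisson P Φ) {h r : ℝ≥0}
    (hrh : 2 * r < h) (hsmall : 3 ^ d * (lam * h ^ d) < 1) :
    P {ω | SetPercolates (coveredSet (Φ ω) 1 r)} = 0 := by
  have hh : 0 < h := lt_of_le_of_lt zero_le hrh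
  have hrh' : 2 * (r : ℝ) < h := by exact_mod_cast hrh
  have hh' : (0 : ℝ) < h := by exact_mod_cast hh
  set p : ℝ≥0∞ := lam * (h : ℝ≥0∞) ^ d with hp
  let X : Ω → Set (Fin d → ℤ) := fun ω => {u | (Φ ω).1 (cell (h : ℝ) u) ≠ 0}
  have hX : ∀ (n : ℕ) (z : Fin n → Fin d → ℤ), Function.Injective z →
      P {ω | ∀ i, z i ∈ X ω} ≤ p ^ n := by
    intro n z hz
    refine (hα.measure_forall_ne_zero_le hΦ (fun i => isBddBorel_cell hh' (z i))
      fun i j hij => disjoint_cell _ fun h => hij (hz h)).trans (le_of_eq ?_)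
    simp [hint _ (isBddBorel_cell hh' _), volume_cell hh, hp]
  -- The shift by 1 encodes the increments -1, 0, 1, which gives the factor `3 ^ d`.
  let step : (Fin d → Fin 3) → (Fin d → ℤ) → Fin d → ℤ := fun t u l => u l + ((t l : ℕ) : ℤ) - 1
  let E : (Fin d → ℤ) → ℕ → Set Ω := fun z n => {ω | ∃ q : ℕ → Fin d → ℤ, q 0 = z ∧
    InjOn q (Iic n) ∧ (∀ i < n, ∃ t, q (i + 1) = step t (q i)) ∧ ∀ i ≤ n, q i ∈ X ω}
  have hE : ∀ z, P (⋂ n, E z n) = 0 := by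
    intro z
    have hlt : (Fintype.card (Fin d → Fin 3) : ℝ≥0∞) * p < 1 := by
      simp only [Fintype.card_fun, Fintype.card_fin, hp]
      exact_mod_cast hsmall
    have hlim := ENNReal.Tendsto.const_mul (a := p)
      (ENNReal.tendsto_pow_atTop_nhds_zero_of_lt_one hlt) (Or.inr (by finiteness))
    rw [mul_zero] at hlim
    exact le_antisymm (ge_of_tendsto' hlim fun n => (measure_mono (iInter_subset _ n)).trans
      (measure_exists_path_le P step X p hX z n)) zero_le
  have hsub : {ω | SetPercolates (coveredSet (Φ ω) 1 r)} ⊆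
      {ω | ¬ ∀ x : Space d, (Φ ω).1 {x} ≤ 1} ∪ ⋃ z, ⋂ n, E z n := by
    intro ω hω
    by_cases hμ : ∀ x : Space d, (Φ ω).1 {x} ≤ 1
    · obtain ⟨z, hz⟩ := exists_cell_path hrh'
        ((setPercolates_iff_graphPercolates (j := 0) hμ).1 hω)
      refine Or.inr (mem_iUnion.2 ⟨z, mem_iInter.2 fun n => ?_⟩)
      obtain ⟨q, h0, hinj, hadj, hocc⟩ := hz n
      refine ⟨q, h0, hinj, fun i hi => ?_, hocc⟩
      have h1 := fun l => abs_le.1 (hadj i hi l)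
      refine ⟨fun l => ⟨(q (i + 1) l - q i l + 1).toNat, by have := h1 l; omega⟩, funext fun l => ?_⟩
      have := h1 l
      simp only [step]
      omega
    · exact Or.inl hμ
  exact measure_mono_null hsub (measure_union_null hs (measure_iUnion_null hE))

/-- The lower bound for the critical radius, uniform over all `α`-weakly sub-Poisson processes. -/
theorem exists_le_criticalRadius (hd : 1 ≤ d) (lam : ℝ≥0) :
    ∃ c : ℝ≥0, 0 < c ∧ ∀ (Ω : Type*) [MeasurableSpace Ω] (P : Measure Ω)
      (Φ : Ω → CountingMeasure d), IsPointProcess Φ → IsSimplePP P Φ → HasIntensity P Φ lam →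
        AlphaWeaklySubPoisson P Φ → (c : ℝ≥0∞) ≤ criticalRadius P Φ 1 := by
  set a : ℝ≥0 := 3 ^ d * lam with ha
  -- As `h ≤ 1` and `d ≥ 1`, `a * h ^ d ≤ a / (1 + a) < 1`.
  set h : ℝ≥0 := (1 + a)⁻¹ with hh
  have h0 : 0 < h := by positivity
  have h1 : h ≤ 1 := inv_le_one_of_one_le₀ (by simp)
  have hsmall : 3 ^ d * (lam * h ^ d) < 1 := by
    calc 3 ^ d * (lam * h ^ d) = a * h ^ d := by rw [ha]; ring
      _ ≤ a * h := by gcongr; exact pow_le_of_le_one zero_le h1 (by omega)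
      _ < (1 + a) * h := by gcongr; exact lt_one_add a
      _ = 1 := mul_inv_cancel₀ (by positivity)
  refine ⟨h / 2, by positivity, fun Ω _ P Φ hΦ hs hint hα => le_sInf ?_⟩
  rintro _ ⟨r, rfl, hr⟩
  by_contra hlt
  rw [not_le, ENNReal.coe_lt_coe, lt_div_iff₀ (by positivity), mul_comm] at hlt
  exact hr.ne' (measure_setPercolates_eq_zero hΦ hs hint hα hlt hsmall)

end LowerBound

/-! ### Percolation at large radius -/

section UpperBound

variable {d : ℕ}

/-- The index of the `j`-th of the `k` cells attached to a site of `ℤ × ℤ`. -/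
def siteIndex (d k : ℕ) (s : ℤ × ℤ) (j : ℕ) : Fin d → ℤ := fun l =>
  if l.1 = 0 then k * s.1 + j else if l.1 = 1 then s.2 else 0

theorem siteIndex_zero (hd : 2 ≤ d) (k : ℕ) (s : ℤ × ℤ) (j : ℕ) :
    siteIndex d k s j ⟨0, by omega⟩ = k * s.1 + j := rfl

theorem siteIndex_one (hd : 2 ≤ d) (k : ℕ) (s : ℤ × ℤ) (j : ℕ) :
    siteIndex d k s j ⟨1, by omega⟩ = s.2 := rfl

/-- Division with remainder by `k` in the first coordinate. -/
theorem siteIndex_injective (hd : 2 ≤ d) {k : ℕ} {s t : ℤ × ℤ} {i j : ℕ} (hi : i < k) (hj : j < k)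
    (h : siteIndex d k s i = siteIndex d k t j) : s = t ∧ i = j := by
  have h0 := congrFun h ⟨0, by omega⟩
  have h1 := congrFun h ⟨1, by omega⟩
  rw [siteIndex_zero hd, siteIndex_zero hd] at h0
  rw [siteIndex_one hd, siteIndex_one hd] at h1
  have hk : (k : ℤ) ≠ 0 := by omega
  have hdiv : ∀ (a : ℤ) (l : ℕ), l < k → ((k : ℤ) * a + l) / k = a := fun a l hl => by
    rw [add_comm, Int.add_mul_ediv_left _ _ hk, Int.ediv_eq_zero_of_lt (by omega) (by omega),
      zero_add]
  have h2 : s.1 = t.1 := by rw [← hdiv s.1 i hi, h0, hdiv t.1 j hj]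
  rw [h2] at h0
  exact ⟨Prod.ext h2 h1, by omega⟩

/-- The corner of the first cell attached to a site. -/
noncomputable def siteCenter (d k : ℕ) (h : ℝ) (s : ℤ × ℤ) : Space d :=
  WithLp.toLp 2 fun l => h * siteIndex d k s 0 l

theorem dist_le_of_mem_cell {k : ℕ} {h : ℝ} (hh : 0 < h) {s : ℤ × ℤ} {j : ℕ} (hj : j < k)
    {x : Space d} (hx : x ∈ cell h (siteIndex d k s j)) :
    dist x (siteCenter d k h s) ≤ d * (k * h) := by
  rw [dist_eq_norm]
  refine EuclideanSpace.norm_le_of_forall_abs_le (by positivity) fun l => ?_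
  obtain ⟨h1, h2⟩ := (mem_cell_iff hh).1 hx l
  have hjk : (j : ℝ) + 1 ≤ k := by exact_mod_cast hj
  have h3 : h * (j + 1) ≤ h * k := by gcongr
  have h4 : 0 ≤ h * j := by positivity
  change |x l - h * siteIndex d k s 0 l| ≤ _
  simp only [siteIndex] at h1 h2 ⊢
  rw [abs_le]
  split_ifs at h1 h2 ⊢ <;> push_cast at h1 h2 ⊢ <;> constructor <;> nlinarith

theorem dist_siteCenter_le {k : ℕ} (hk : 1 ≤ k) {h : ℝ} (hh : 0 < h) {s t : ℤ × ℤ}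
    (hst : PlaneAdj s t) : dist (siteCenter d k h s) (siteCenter d k h t) ≤ d * (k * h) := by
  rw [dist_eq_norm]
  refine EuclideanSpace.norm_le_of_forall_abs_le (by positivity) fun l => ?_
  have hk' : (1 : ℝ) ≤ k := by exact_mod_cast hk
  change |h * siteIndex d k s 0 l - h * siteIndex d k t 0 l| ≤ _
  rw [← mul_sub, abs_mul, abs_of_pos hh, mul_comm]
  gcongr
  simp only [siteIndex]
  rw [← Int.cast_sub, ← Int.cast_abs]
  rcases hst with ⟨h1, h2⟩ | ⟨h1, h2⟩
  · split_ifs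
    · simp [h1]
    · rw [abs_sub_comm, h2]; simpa using hk'
    · simp
  · split_ifs
    · have : ((k : ℤ) * s.1 + (0 : ℕ) - (k * t.1 + (0 : ℕ))) = -(k * (t.1 - s.1)) := by push_cast; ring
      rw [this, abs_neg, abs_mul, h2]
      simp
    · simp [h1]
    · simp

/-- With `R = d * (k * h)`, a point of the ball and a point of any of the `k` cubes are both within
`R` of the centre, hence within `2R ≤ r` of each other; the cubes are disjoint, so their counts add
up to at least `k`. -/
theorem closedBall_subset_coveredSet (hd : 2 ≤ d) (μ : CountingMeasure d) {k : ℕ} {h : ℝ}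
    (hh : 0 < h) {r : ℝ≥0} (hr : 2 * (d * (k * h)) ≤ r) {s : ℤ × ℤ}
    (hs : ∀ j < k, μ.1 (cell h (siteIndex d k s j)) ≠ 0) :
    Metric.closedBall (siteCenter d k h s) (d * (k * h)) ⊆ coveredSet μ k r := by
  intro w hw
  rw [coveredSet, mem_ofPred_eq, coverage_eq]
  calc (k : ℝ≥0∞) = ∑ _j : Fin k, 1 := by simp
    _ ≤ ∑ j : Fin k, μ.1 (cell h (siteIndex d k s j)) :=
        Finset.sum_le_sum fun j _ => μ.one_le_apply (isBddBorel_cell hh _) (hs j j.2)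
    _ = μ.1 (⋃ j : Fin k, cell h (siteIndex d k s j)) := by
        rw [measure_iUnion (fun i j hij => disjoint_cell h fun heq =>
          hij (Fin.ext (siteIndex_injective hd i.2 j.2 heq).2))
          fun j => (isBddBorel_cell hh _).1, tsum_fintype]
    _ ≤ _ := by
        refine measure_mono (iUnion_subset fun j x hx => ?_)
        have h1 := dist_le_of_mem_cell hh j.2 hx
        have h2 := dist_triangle_right x w (siteCenter d k h s)
        rw [Metric.mem_closedBall] at hw ⊢
        linarith

-- Neighbouring sites have centres within the common ball radius, so the balls along the cluster
-- chain up to a connected set; it is unbounded because a bounded region contains only finitely many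
-- centres.
open Relation in
theorem setPercolates_of_infinite_cluster (hd : 2 ≤ d) (μ : CountingMeasure d) {k : ℕ}
    (hk : 1 ≤ k) {h : ℝ} (hh : 0 < h) {r : ℝ≥0} (hr : 2 * (d * (k * h)) ≤ r) {X : Set (ℤ × ℤ)}
    (hX : ∀ s ∈ X, ∀ j < k, μ.1 (cell h (siteIndex d k s j)) ≠ 0) (h0 : (0, 0) ∈ X)
    (hinf : {v | ReflTransGen (fun u v => PlaneAdj u v ∧ v ∈ X) (0, 0) v}.Infinite) :
    SetPercolates (coveredSet μ k r) := by
  set A := {v | ReflTransGen (fun u v => PlaneAdj u v ∧ v ∈ X) (0, 0) v}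
  have hAX : ∀ v ∈ A, v ∈ X := by
    intro v hv
    rcases ReflTransGen.cases_tail hv with h | ⟨_, _, h⟩
    · exact h ▸ h0
    · exact h.2
  set R : ℝ := d * (k * h) with hR
  have hR0 : 0 ≤ R := by positivity
  have hself : ∀ v, siteCenter d k h v ∈ Metric.closedBall (siteCenter d k h v) R :=
    fun v => Metric.mem_closedBall_self hR0
  have hchain : ∀ v ∈ A, ReflTransGen (fun i j : ℤ × ℤ =>
      (Metric.closedBall (siteCenter d k h i) R ∩ Metric.closedBall (siteCenter d k h j) R).Nonempty
        ∧ i ∈ A ∧ j ∈ A) (0, 0) v := by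
    intro v hv
    induction (show ReflTransGen _ _ v from hv) with
    | refl => exact .refl
    | tail h1 h2 ih =>
      exact (ih h1).tail ⟨⟨_, dist_siteCenter_le hk hh h2.1.symm, hself _⟩, h1, h1.tail h2⟩
  refine ⟨⋃ v ∈ A, Metric.closedBall (siteCenter d k h v) R, ?_, ?_, ?_⟩
  · exact iUnion₂_subset fun v hv => closedBall_subset_coveredSet hd μ hh hr (hX v (hAX v hv))
  · refine IsConnected.biUnion_of_reflTransGen ⟨(0, 0), .refl⟩ (fun v _ => ⟨⟨_, hself v⟩,
      (convex_closedBall _ _).isPreconnected⟩) fun i hi j hj => ?_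
    have hi' := (hchain i hi).swap
    refine ReflTransGen.trans (ReflTransGen.mono (fun a b hab => ?_) _ _ hi')
      (ReflTransGen.mono (fun a b hab => ⟨hab.1, hab.2.1⟩) _ _ (hchain j hj))
    exact ⟨by rw [inter_comm]; exact hab.1, hab.2.2⟩
  · intro hb
    obtain ⟨C, hC⟩ := isBounded_iff_forall_norm_le.1 hb
    refine hinf ((Set.finite_Icc ((-⌈C / h⌉, -⌈C / h⌉) : ℤ × ℤ) (⌈C / h⌉, ⌈C / h⌉)).subset ?_)
    intro v hv
    have h1 : ‖siteCenter d k h v‖ ≤ C := hC _ (mem_iUnion₂.2 ⟨v, hv, hself v⟩)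
    have h2 : ∀ l, |siteIndex d k v 0 l| ≤ ⌈C / h⌉ := fun l => by
      have h3 : |h * (siteIndex d k v 0 l : ℝ)| ≤ C :=
        (PiLp.norm_apply_le (siteCenter d k h v) l).trans h1
      rw [abs_mul, abs_of_pos hh, mul_comm, ← le_div_iff₀ hh, ← Int.cast_abs] at h3
      exact_mod_cast h3.trans (Int.le_ceil _)
    have h3 := h2 ⟨0, by omega⟩
    have h4 := h2 ⟨1, by omega⟩
    rw [siteIndex_zero hd, Nat.cast_zero, add_zero, abs_mul, Nat.abs_cast] at h3
    rw [siteIndex_one hd, abs_le] at h4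
    have h5 : |v.1| ≤ ⌈C / h⌉ := le_trans (le_mul_of_one_le_left (abs_nonneg _)
      (by exact_mod_cast hk)) h3
    rw [abs_le] at h5
    exact ⟨⟨h5.1, h4.1⟩, h5.2, h4.2⟩

variable {Ω : Type*} [MeasurableSpace Ω] {P : Measure Ω} {Φ : Ω → CountingMeasure d}

/-- All the cubes are empty exactly when their union is, and the mean of the union is `n * (lam * h
^ d)`: the exponential factorises without independence. -/
theorem NuWeaklySubPoisson.measure_iUnion_cell_le {lam h : ℝ≥0} (hν : NuWeaklySubPoisson P Φ)
    (hint : HasIntensity P Φ lam) (hh : 0 < h) {n : ℕ} {z : Fin n → Fin d → ℤ}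
    (hz : Function.Injective z) :
    P {ω | ∀ i, (Φ ω).1 (cell h (z i)) = 0} ≤
      ENNReal.ofReal (Real.exp (-(lam * h ^ d))) ^ n := by
  have hh' : (0 : ℝ) < h := by exact_mod_cast hh
  have hB : IsBddBorel (⋃ i, cell (h : ℝ) (z i)) :=
    ⟨MeasurableSet.iUnion fun i => (isBddBorel_cell hh' _).1,
      Bornology.isBounded_iUnion.2 fun i => (isBddBorel_cell hh' _).2⟩
  have hmean : meanCount P Φ (⋃ i, cell (h : ℝ) (z i)) =
      ENNReal.ofReal (n * (lam * h ^ d)) := by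
    rw [hint _ hB, measure_iUnion (fun i j hij => disjoint_cell _ fun heq => hij (hz heq))
      fun i => (isBddBorel_cell hh' _).1, tsum_fintype]
    simp only [volume_cell hh, Finset.sum_const, Finset.card_univ, Fintype.card_fin, nsmul_eq_mul]
    have : (n * (lam * h ^ d) : ℝ) = ((n * (lam * h ^ d) : ℝ≥0) : ℝ) := by push_cast; rfl
    rw [this, ENNReal.ofReal_coe_nnreal]
    push_cast
    ring
  have h1 := hν _ hB
  rw [hmean, EReal.coe_ennreal_ofReal, max_eq_left (by positivity), ← EReal.coe_neg,
    EReal.exp_coe] at h1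
  have h2 : {ω | (Φ ω).1 (⋃ i, cell (h : ℝ) (z i)) = 0} =
      {ω | ∀ i, (Φ ω).1 (cell h (z i)) = 0} := by
    ext ω
    exact measure_iUnion_null_iff
  rw [h2] at h1
  refine h1.trans (le_of_eq ?_)
  rw [← ENNReal.ofReal_pow (Real.exp_nonneg _), ← Real.exp_nat_mul]
  congr 2
  ring

theorem measure_setPercolates_pos [IsProbabilityMeasure P] (hd : 2 ≤ d) {lam h : ℝ≥0}
    (hν : NuWeaklySubPoisson P Φ) (hint : HasIntensity P Φ lam) (hh : 0 < h) {k : ℕ} (hk : 1 ≤ k)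
    (hsmall : 18 * (k * Real.exp (-(lam * h ^ d))) ≤ 1) :
    0 < P {ω | SetPercolates (coveredSet (Φ ω) k (2 * (d * (k * h))))} := by
  have hh' : (0 : ℝ) < h := by exact_mod_cast hh
  -- The factor `k` counts the choices of an empty cube at a bad site.
  set p : ℝ≥0∞ := k * ENNReal.ofReal (Real.exp (-(lam * h ^ d))) with hp
  let X : Ω → Set (ℤ × ℤ) := fun ω =>
    {s | ∃ j : Fin k, (Φ ω).1 (cell h (siteIndex d k s j)) = 0}
  have hX : ∀ (n : ℕ) (z : Fin n → ℤ × ℤ), Function.Injective z →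
      P {ω | ∀ i, z i ∈ X ω} ≤ p ^ n := by
    intro n z hz
    calc P {ω | ∀ i, z i ∈ X ω}
        ≤ P (⋃ J : Fin n → Fin k,
          {ω | ∀ i, (Φ ω).1 (cell h (siteIndex d k (z i) (J i))) = 0}) := by
          refine measure_mono fun ω hω => ?_
          choose J hJ using hω
          exact mem_iUnion.2 ⟨J, hJ⟩
      _ ≤ ∑ J : Fin n → Fin k, P {ω | ∀ i, (Φ ω).1 (cell h (siteIndex d k (z i) (J i))) = 0} :=
          measure_iUnion_fintype_le _ _
      _ ≤ ∑ J : Fin n → Fin k, ENNReal.ofReal (Real.exp (-(lam * h ^ d))) ^ n :=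
          Finset.sum_le_sum fun J _ => hν.measure_iUnion_cell_le hint hh fun a b hab =>
            hz (siteIndex_injective hd (J a).2 (J b).2 hab).1
      _ = p ^ n := by simp [hp, mul_pow]
  -- 18 = 9 · 2: nine star-steps and a geometric ratio of at most 1/2, so the bad paths have total
  -- probability at most `2 * p ≤ 1/9`.
  have hp18 : 18 * p ≤ 1 := by
    have : 18 * p = ENNReal.ofReal (18 * (k * Real.exp (-(lam * h ^ d)))) := by
      rw [ENNReal.ofReal_mul (by norm_num), ENNReal.ofReal_mul (by positivity)]
      simp [hp]
    rw [this]
    exact ENNReal.ofReal_le_one.2 hsmall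
  let step : Fin 3 × Fin 3 → ℤ × ℤ → ℤ × ℤ := fun t u =>
    (u.1 + ((t.1 : ℕ) : ℤ) - 1, u.2 + ((t.2 : ℕ) : ℤ) - 1)
  let E : ℕ → Set Ω := fun m => {ω | ∃ q : ℕ → ℤ × ℤ, q 0 = ((m : ℤ), 0) ∧
    InjOn q (Iic m) ∧ (∀ i < m, ∃ t, q (i + 1) = step t (q i)) ∧ ∀ i ≤ m, q i ∈ X ω}
  have h9 : (Fintype.card (Fin 3 × Fin 3) : ℝ≥0∞) * p ≤ 2⁻¹ := by
    rw [ENNReal.le_inv_iff_mul_le]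
    refine le_trans (le_of_eq ?_) hp18
    simp only [Fintype.card_prod, Fintype.card_fin]
    push_cast
    ring
  have hE : P (⋃ m, E m) ≤ p * 2 := by
    calc P (⋃ m, E m) ≤ ∑' m, P (E m) := measure_iUnion_le _
      _ ≤ ∑' m : ℕ, p * 2⁻¹ ^ m := ENNReal.tsum_le_tsum fun m =>
          (measure_exists_path_le P step X p hX _ m).trans (by gcongr)
      _ = p * 2 := by rw [ENNReal.tsum_mul_left, ENNReal.tsum_geometric, ENNReal.one_sub_inv_two,
          inv_inv]
  -- Covering the whole space uses only subadditivity, so the percolation event need not be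
  -- measurable.
  have hcover : (univ : Set Ω) ⊆
      {ω | SetPercolates (coveredSet (Φ ω) k (2 * (d * (k * h))))} ∪ ⋃ m, E m := by
    intro ω _
    by_cases hω : ω ∈ ⋃ m, E m
    · exact Or.inr hω
    left
    have hno : ¬ ∃ (m : ℕ) (q : ℕ → ℤ × ℤ), q 0 = ((m : ℤ), 0) ∧ InjOn q (Iic m) ∧
        (∀ i < m, PlaneStarAdj (q i) (q (i + 1))) ∧ ∀ i ≤ m, q i ∉ (X ω)ᶜ := by
      rintro ⟨m, q, h0, hinj, hadj, hbad⟩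
      refine hω (mem_iUnion.2 ⟨m, q, h0, hinj, fun i hi => ?_, fun i hi => not_not.1 (hbad i hi)⟩)
      have h1 := abs_le.1 (hadj i hi).1
      have h2 := abs_le.1 (hadj i hi).2
      refine ⟨(⟨((q (i + 1)).1 - (q i).1 + 1).toNat, by omega⟩,
        ⟨((q (i + 1)).2 - (q i).2 + 1).toNat, by omega⟩), Prod.ext ?_ ?_⟩ <;>
      simp only [step] <;> omega
    refine setPercolates_of_infinite_cluster hd (Φ ω) hk hh' (by push_cast; exact le_rfl)
      (X := (X ω)ᶜ) (fun s hs j hj h0 => hs ⟨⟨j, hj⟩, h0⟩) (fun h0 => ?_)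
      fun hfin => hno (exists_star_path_of_finite_cluster hfin)
    refine hno ⟨0, fun _ => (0, 0), rfl, fun i hi j hj _ =>
      (Nat.le_zero.1 hi).trans (Nat.le_zero.1 hj).symm, by simp, fun i _ h => h h0⟩
  rw [pos_iff_ne_zero]
  intro h0
  have h1 : (1 : ℝ≥0∞) ≤ p * 2 := by
    calc (1 : ℝ≥0∞) = P univ := measure_univ.symm
      _ ≤ _ := measure_mono hcover
      _ ≤ _ := measure_union_le _ _
      _ ≤ p * 2 := by rw [h0, zero_add]; exact hE
  have h2 : (9 : ℝ≥0∞) ≤ 1 := by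
    calc (9 : ℝ≥0∞) = 9 * 1 := by simp
      _ ≤ 9 * (p * 2) := by gcongr
      _ = 18 * p := by ring
      _ ≤ 1 := hp18
  norm_num at h2

/-- The upper bound for the critical radii, uniform over all `ν`-weakly sub-Poisson processes. -/
theorem exists_criticalRadius_le (hd : 2 ≤ d) {lam : ℝ≥0} (hlam : 0 < lam) {k : ℕ} (hk : 1 ≤ k) :
    ∃ c : ℝ≥0, ∀ (Ω : Type*) [MeasurableSpace Ω] (P : Measure Ω) [IsProbabilityMeasure P]
      (Φ : Ω → CountingMeasure d), HasIntensity P Φ lam → NuWeaklySubPoisson P Φ →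
        criticalRadius P Φ k ≤ c := by
  -- Chosen so that `lam * h ≥ log (18 * k)`; the summand 1 gives `h ≤ h ^ d`.
  set h : ℝ≥0 := 1 + (Real.log (18 * k) / lam).toNNReal with hh
  have hk' : (1 : ℝ) ≤ k := by exact_mod_cast hk
  have hlam' : (0 : ℝ) < lam := by exact_mod_cast hlam
  have h1 : (1 : ℝ) ≤ h := by rw [hh]; simp
  have h2 : Real.log (18 * k) ≤ lam * h ^ d := by
    have h3 : Real.log (18 * k) / lam ≤ h := by
      rw [hh]
      push_cast
      linarith [Real.le_coe_toNNReal (Real.log (18 * k) / lam)]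
    rw [div_le_iff₀' hlam'] at h3
    refine h3.trans ?_
    gcongr
    exact le_self_pow₀ h1 (by omega)
  have hsmall : 18 * (k * Real.exp (-(lam * h ^ d))) ≤ 1 := by
    rw [← mul_assoc, Real.exp_neg, ← div_eq_mul_inv, div_le_one (Real.exp_pos _)]
    calc (18 * k : ℝ) = Real.exp (Real.log (18 * k)) := (Real.exp_log (by positivity)).symm
      _ ≤ _ := Real.exp_le_exp.2 h2
  refine ⟨2 * (d * (k * h)), fun Ω _ P _ Φ hint hν => sInf_le ⟨_, rfl, ?_⟩⟩
  exact measure_setPercolates_pos hd hν hint (by positivity) hk hsmall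

end UpperBound

/-! ### Comparison of critical radii and the main theorem -/

section CriticalRadii

variable {d : ℕ} {Ω : Type*} [MeasurableSpace Ω] {P : Measure Ω} {Φ : Ω → CountingMeasure d}

theorem criticalRadius_mono {k l : ℕ} (hkl : k ≤ l) :
    criticalRadius P Φ k ≤ criticalRadius P Φ l := by
  refine sInf_le_sInf ?_
  rintro _ ⟨r, rfl, hr⟩
  refine ⟨r, rfl, hr.trans_le (measure_mono ?_)⟩
  rintro ω ⟨S, hS, hS'⟩
  exact ⟨S, fun y hy => (Nat.cast_le.2 hkl : (k : ℝ≥0∞) ≤ l).trans (hS hy), hS'⟩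

theorem IsSimplePP.ae_percolates_iff (hs : IsSimplePP P Φ) :
    ∀ᵐ ω ∂P, ∀ k : ℕ, 1 ≤ k → ∀ r : ℝ≥0, (SetPercolates (coveredSet (Φ ω) k r) ↔
      GraphPercolates (cechFaceGraph (Φ ω) r (k - 1))) := by
  filter_upwards [hs] with ω hω k hk r
  obtain ⟨j, rfl⟩ := Nat.exists_eq_add_of_le' hk
  exact setPercolates_iff_graphPercolates hω

theorem IsSimplePP.cliqueCriticalRadius_eq (hs : IsSimplePP P Φ) {k : ℕ} (hk : 1 ≤ k) :
    cliqueCriticalRadius P Φ (k - 1) = criticalRadius P Φ k := by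
  have h : ∀ r : ℝ≥0, P {ω | GraphPercolates (cechFaceGraph (Φ ω) r (k - 1))} =
      P {ω | SetPercolates (coveredSet (Φ ω) k r)} := by
    intro r
    refine measure_congr ?_
    filter_upwards [hs.ae_percolates_iff] with ω hω
    exact propext (hω k hk r).symm
  simp only [cliqueCriticalRadius, criticalRadius, h]

end CriticalRadii

theorem mainTheorem1 (d : ℕ) (hd : 1 ≤ d) :
    (∃ (c : ℝ≥0 → ℝ≥0) (c' : ℝ≥0 → ℕ → ℝ≥0),
      (∀ lam : ℝ≥0, 0 < lam → 0 < c lam) ∧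
      ∀ (lam : ℝ≥0), 0 < lam →
        ∀ (Ω : Type*) [MeasurableSpace Ω] (P : Measure Ω) [IsProbabilityMeasure P]
          (Φ : Ω → CountingMeasure d),
          IsPointProcess Φ → IsSimplePP P Φ → IsStationaryPP P Φ → HasIntensity P Φ lam →
          (AlphaWeaklySubPoisson P Φ → (c lam : ℝ≥0∞) ≤ criticalRadius P Φ 1) ∧
          (2 ≤ d → NuWeaklySubPoisson P Φ →
            ∀ k : ℕ, 1 ≤ k → criticalRadius P Φ k ≤ (c' lam k : ℝ≥0∞)) ∧
          (2 ≤ d → WeaklySubPoisson P Φ → ∀ k : ℕ, 1 ≤ k →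
            0 < (c lam : ℝ≥0∞) ∧
            (c lam : ℝ≥0∞) ≤ criticalRadius P Φ 1 ∧
            criticalRadius P Φ 1 ≤ criticalRadius P Φ k ∧
            criticalRadius P Φ k ≤ (c' lam k : ℝ≥0∞) ∧
            (c' lam k : ℝ≥0∞) < ∞ ∧
            (c lam : ℝ≥0∞) ≤ cliqueCriticalRadius P Φ (k - 1) ∧
            cliqueCriticalRadius P Φ (k - 1) ≤ (c' lam k : ℝ≥0∞))) ∧
    (∀ (Ω : Type*) [MeasurableSpace Ω] (P : Measure Ω) [IsProbabilityMeasure P]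
      (Φ : Ω → CountingMeasure d), IsPointProcess Φ → IsSimplePP P Φ →
      (∀ᵐ ω ∂P, ∀ (k : ℕ), 1 ≤ k → ∀ r : ℝ≥0,
        (SetPercolates (coveredSet (Φ ω) k r) ↔
          GraphPercolates (cechFaceGraph (Φ ω) r (k - 1)))) ∧
      ∀ k : ℕ, 1 ≤ k → cliqueCriticalRadius P Φ (k - 1) = criticalRadius P Φ k) := by
  refine ⟨?_, fun Ω _ P _ Φ _ hs => ⟨hs.ae_percolates_iff, fun k hk =>
    hs.cliqueCriticalRadius_eq hk⟩⟩
  choose c hc0 hc using fun lam => exists_le_criticalRadius hd lam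
  have hc' : ∀ (lam : ℝ≥0) (k : ℕ), ∃ c' : ℝ≥0, 2 ≤ d → 0 < lam → 1 ≤ k →
      ∀ (Ω : Type _) [MeasurableSpace Ω] (P : Measure Ω) [IsProbabilityMeasure P]
        (Φ : Ω → CountingMeasure d), HasIntensity P Φ lam → NuWeaklySubPoisson P Φ →
          criticalRadius P Φ k ≤ c' := by
    intro lam k
    by_cases h : 2 ≤ d ∧ 0 < lam ∧ 1 ≤ k
    · obtain ⟨c', h'⟩ := exists_criticalRadius_le h.1 h.2.1 h.2.2
      exact ⟨c', fun _ _ _ => h'⟩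
    -- A dummy value, so that `c'` is a total function of `lam` and `k` alone.
    · exact ⟨0, fun h1 h2 h3 => absurd ⟨h1, h2, h3⟩ h⟩
  choose c' hc' using hc'
  refine ⟨c, c', fun lam _ => hc0 lam, fun lam hlam Ω _ P _ Φ hΦ hs _ hint => ?_⟩
  have lower := hc lam Ω P Φ hΦ hs hint
  have upper : 2 ≤ d → NuWeaklySubPoisson P Φ → ∀ k : ℕ, 1 ≤ k →
      criticalRadius P Φ k ≤ (c' lam k : ℝ≥0∞) := fun h2 hν k hk =>
    hc' lam k h2 hlam hk Ω P Φ hint hν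
  refine ⟨lower, upper, fun h2 hw k hk => ?_⟩
  have hlow := lower hw.2
  have hmono : criticalRadius P Φ 1 ≤ criticalRadius P Φ k := criticalRadius_mono hk
  have hup := upper h2 hw.1 k hk
  rw [hs.cliqueCriticalRadius_eq hk]
  exact ⟨by exact_mod_cast hc0 lam, hlow, hmono, hup, ENNReal.coe_lt_top, hlow.trans hmono, hup⟩
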